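/- Let $d\ge 1$, let $p>1$, with $p<\frac{d+2}{d-2}$ if $d\ge 3$, let $\beta>0$, and let $V:\mathbb R^d\to[0,\infty)$ be measurable with $V(x)\to\infty$ as $|x|\to\infty$. Put $L_z=i(x_2\partial_{x_1}-x_1\partial_{x_2})$ if $d\ge2$ and $L_z=0$ if $d=1$, and assume that $\Omega\in\mathbb R$ satisfies $\Omega=0$ or $0<|\Omega|<\Omega_{\max}$, where $$\Omega_{\max}=\sup\Big\{\gamma>0:\ \lim_{|x|\to\infty}\Big(V(x)-\tfrac{\gamma^2}{2}(x_1^2+x_2^2)\Big)=\infty\Big\}\le\infty$$ (for $d=1$ there is no rotation and $x_1^2+x_2^2$ is read as $0$, so that $\Omega$ is unrestricted). Let $X=\{\phi\in H^1(\mathbb R^d;\mathbb C):\int V|\phi|^2\,dx<\infty\}$ and, for $\phi\in X$ and $\omega\in\mathbb R$, $$E(\phi)=\tfrac12\|\nabla\phi\|_{L^2}^2+\int V|\phi|^2\,dx+\tfrac{2\beta}{p+1}\|\phi\|_{L^{p+1}}^{p+1}-\Omega\int\overline{\phi}\,L_z\phi\,dx,\qquad S_{\Omega,\omega}(\phi)=E(\phi)+\omega\|\phi\|_{L^2}^2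 .$$ An *action ground state for $\omega$* is a minimizer of $S_{\Omega,\omega}$ among all $\phi\in X\setminus\{0\}$ that solve $$-\tfrac12\Delta\phi+V\phi+\beta|\phi|^{p-1}\phi-\Omega L_z\phi+\omega\phi=0$$ weakly (tested against all functions in $X$). An *energy ground state with mass $m$* is a minimizer of $E$ among all $\phi\in X$ with $\|\phi\|_{L^2}^2=m$. Let $\mathcal N_{\Omega,\omega}$ be the set of all masses $\|\phi\|_{L^2}^2$ of action ground states $\phi$ for $\omega$, let $$\lambda_0(\Omega)=\inf_{0\ne\phi\in X}\frac{\int\big(\frac12|\nabla\phi|^2+V|\phi|^2-\Omega\,\overline{\phi}\,L_z\phi\big)dx}{\|\phi\|_{L^2}^2},$$ and, for $\omega<-\lambda_0(\Omega)$, let $\mathcal I(\omega)=[\inf\mathcal N_{\Omega,\omega},\ \sup\mathcal N_{\Omega,\omega}]$. **Theorem.** Suppose that for some $\tilde\omega<-\lambda_0(\Omega)$ the set $\mathcal I(\tilde\omega)\setminus\mathcal N_{\Omega,\tilde\omega}$ is non-empty. Then for every $m\in\mathcal I(\tilde\omega)\setminus\mathcal N_{\Omega,\tilde\omega}$, no energy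 ground state with mass $m$ is an action ground state for any $\omega\in\mathbb R$. -/

import Mathlib

open MeasureTheory Filter

namespace RNLS

noncomputable section

/-- Physical space `ℝ^d` with its Euclidean structure. -/
abbrev Space (d : ℕ) : Type := EuclideanSpace ℝ (Fin d)

/-- The Hilbert space `L²(ℝ^d; ℂ)` of (classes of) wave functions. The mass of `φ` is `‖φ‖ ^ 2`. -/
abbrev L2 (d : ℕ) : Type := Lp ℂ 2 (volume : Measure (Space d))

open scoped LineDeriv in
/-- `g ∈ L²` is the weak (distributional) partial derivative `∂_{x_i} φ` of `φ ∈ L²`. -/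
def IsWeakPartial {d : ℕ} (i : Fin d) (φ g : L2 d) : Prop :=
  ∂_{(EuclideanSpace.single i (1 : ℝ) : Space d)} (Lp.toTemperedDistribution φ) =
    Lp.toTemperedDistribution g

/-- A weak partial derivative is unique as an element of `L²`. -/
theorem IsWeakPartial.unique {d : ℕ} {i : Fin d} {φ g g' : L2 d}
    (h : IsWeakPartial i φ g) (h' : IsWeakPartial i φ g') : g = g' := by
  have hk := MeasureTheory.Lp.ker_toTemperedDistributionCLM_eq_bot
    (F := ℂ) (E := Space d) (μ := volume) (p := 2)
  have hinj := LinearMap.ker_eq_bot.mp hk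
  exact hinj (h.symm.trans h')

open Classical in
/-- The weak partial derivative `∂_{x_i} φ` (meaningful if it exists in `L²`). -/
def weakPartial {d : ℕ} (i : Fin d) (φ : L2 d) : L2 d :=
  if h : ∃ g, IsWeakPartial i φ g then h.choose else 0

theorem weakPartial_eq {d : ℕ} {i : Fin d} {φ g : L2 d} (h : IsWeakPartial i φ g) :
    weakPartial i φ = g := by
  have hex : ∃ g, IsWeakPartial i φ g := ⟨g, h⟩
  unfold weakPartial
  rw [dif_pos hex]
  exact hex.choose_spec.unique h

/-- The space `X = H¹(ℝ^d) ∩ L²_V(ℝ^d)`: the functions in `L²` all of whose first order weak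
partial derivatives are in `L²`, with `∫ V |φ|² < ∞`. -/
def X {d : ℕ} (V : Space d → ℝ) : Set (L2 d) :=
  {φ | (∀ i, ∃ g, IsWeakPartial i φ g) ∧ Integrable (fun x ↦ V x * ‖φ x‖ ^ 2)}

/-- The angular momentum operator: `L_z φ = i (x₂ ∂_{x₁} φ - x₁ ∂_{x₂} φ)` if `d ≥ 2`, and
`L_z φ = 0` if `d = 1`. -/
def Lz {d : ℕ} (φ : L2 d) (x : Space d) : ℂ :=
  if h : 2 ≤ d then
    Complex.I * ((x ⟨1, h⟩ : ℂ) * weakPartial ⟨0, by omega⟩ φ x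
      - (x ⟨0, by omega⟩ : ℂ) * weakPartial ⟨1, h⟩ φ x)
  else 0

/-- `x₁² + x₂²`, the squared distance to the rotation axis (`0` if `d = 1`, where there is no
rotation). -/
def axisDistSq {d : ℕ} (x : Space d) : ℝ :=
  if h : 2 ≤ d then x ⟨0, by omega⟩ ^ 2 + x ⟨1, h⟩ ^ 2 else 0

/-- The maximal rotation speed
`Ω_max = sup {γ > 0 : V(x) - (γ² / 2) (x₁² + x₂²) → ∞ as |x| → ∞} ≤ ∞`. -/
def OmegaMax {d : ℕ} (V : Space d → ℝ) : EReal :=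
  sSup ((fun γ : ℝ ↦ (γ : EReal)) ''
    {γ : ℝ | 0 < γ ∧
      Tendsto (fun x ↦ V x - γ ^ 2 / 2 * axisDistSq x) (cocompact (Space d)) atTop})

/-- The rotational energy `L_Ω(φ) = -Ω ∫ conj(φ) L_z φ`; the integral is real for `φ ∈ X`. -/
def rotationEnergy {d : ℕ} (Ω : ℝ) (φ : L2 d) : ℝ :=
  -Ω * (∫ x, starRingEnd ℂ (φ x) * Lz φ x).re

/-- The energy of the linear problem,
`∫ (|∇φ|² / 2 + V |φ|² - Ω conj(φ) L_z φ)`. -/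
def linearEnergy {d : ℕ} (V : Space d → ℝ) (Ω : ℝ) (φ : L2 d) : ℝ :=
  1 / 2 * ∑ i, ‖weakPartial i φ‖ ^ 2 + (∫ x, V x * ‖φ x‖ ^ 2) + rotationEnergy Ω φ

/-- The energy `E(φ)`. -/
def energy {d : ℕ} (V : Space d → ℝ) (p β Ω : ℝ) (φ : L2 d) : ℝ :=
  linearEnergy V Ω φ + 2 * β / (p + 1) * ∫ x, ‖φ x‖ ^ (p + 1)

/-- The action `S_{Ω,ω}(φ) = E(φ) + ω ‖φ‖²`. -/
def action {d : ℕ} (V : Space d → ℝ) (p β Ω ω : ℝ) (φ : L2 d) : ℝ :=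
  energy V p β Ω φ + ω * ‖φ‖ ^ 2

/-- `λ₀(Ω)`, the infimum of the Rayleigh quotient of `-Δ/2 + V - Ω L_z` over `X \ {0}`. -/
def lambda0 {d : ℕ} (V : Space d → ℝ) (Ω : ℝ) : ℝ :=
  sInf ((fun φ ↦ linearEnergy V Ω φ / ‖φ‖ ^ 2) '' (X V \ {0}))

/-- The nontrivial (weak) solutions `φ ∈ X` of the stationary equation
`-Δφ/2 + Vφ + β |φ|^(p-1) φ - Ω L_z φ + ω φ = 0`, tested against all `v ∈ X`. -/
def stationarySolutions {d : ℕ} (V : Space d → ℝ) (p β Ω ω : ℝ) : Set (L2 d) :=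
  {φ | φ ∈ X V ∧ φ ≠ 0 ∧ ∀ v ∈ X V,
    1 / 2 * ∑ i, (∫ x, weakPartial i φ x * starRingEnd ℂ (weakPartial i v x))
      + (∫ x, (V x : ℂ) * φ x * starRingEnd ℂ (v x))
      + (β : ℂ) * (∫ x, ((‖φ x‖ ^ (p - 1) : ℝ) : ℂ) * φ x * starRingEnd ℂ (v x))
      - (Ω : ℂ) * (∫ x, Lz φ x * starRingEnd ℂ (v x))
      + (ω : ℂ) * (∫ x, φ x * starRingEnd ℂ (v x)) = 0}

/-- `𝓐_{Ω,ω}`: the action ground states for `ω`, i.e. the nontrivial stationary solutions of least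
action. -/
def actionGroundStates {d : ℕ} (V : Space d → ℝ) (p β Ω ω : ℝ) : Set (L2 d) :=
  {φ | φ ∈ stationarySolutions V p β Ω ω ∧
    ∀ ψ ∈ stationarySolutions V p β Ω ω, action V p β Ω ω φ ≤ action V p β Ω ω ψ}

/-- `𝓑_{Ω,m}`: the energy ground states with mass `m`. -/
def energyGroundStates {d : ℕ} (V : Space d → ℝ) (p β Ω m : ℝ) : Set (L2 d) :=
  {φ | (φ ∈ X V ∧ ‖φ‖ ^ 2 = m) ∧
    ∀ ψ ∈ X V, ‖ψ‖ ^ 2 = m → energy V p β Ω φ ≤ energy V p β Ω ψ}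

/-- `𝓝_{Ω,ω}`: the set of the masses of the action ground states for `ω`. -/
def massSet {d : ℕ} (V : Space d → ℝ) (p β Ω ω : ℝ) : Set ℝ :=
  (fun φ : L2 d ↦ ‖φ‖ ^ 2) '' actionGroundStates V p β Ω ω

/-- The closed interval `𝓘(ω) = [inf 𝓝_{Ω,ω}, sup 𝓝_{Ω,ω}]`. -/
def massInterval {d : ℕ} (V : Space d → ℝ) (p β Ω ω : ℝ) : Set ℝ :=
  Set.Icc (sInf (massSet V p β Ω ω)) (sSup (massSet V p β Ω ω))

end

end RNLS

/-!
# Energy ground states that are not action ground states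

The interaction is defocusing, and the key fact (`mem_actionGroundStates_iff`) is that, as soon as
there is a nontrivial stationary solution for `ω`, the action ground states for `ω` are exactly
the global minimizers of the action `S_ω` over the whole form domain `X`. Testing the equation
with the solution itself shows that every nontrivial stationary solution has negative action
(`action_neg_of_mem_stationarySolutions`); since `S_ω(0) = 0`, a global minimizer is nonzero, and
it solves the Euler-Lagrange equation (`mem_stationarySolutions_of_minimizer`).

A global minimizer exists (`exists_action_minimizer`) because a minimizing sequence is bounded in
`X` (`exists_action_coercive`), hence has a subsequence converging in `L²`
(`exists_subseq_tendsto`); by the parallelogram law for the quadratic part and convexity of the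
interaction (`action_midpoint_add_le`) that subsequence is Cauchy for the norm of `X`. The weak
derivatives are handled on the Fourier side: cutting off the frequencies `|ξ| > N` gives both the
compactness and the subcritical Sobolev embedding (`integrable_norm_rpow_add_one`). Below the
critical speed the rotation is a relatively bounded perturbation with bound less than one
(`exists_abs_rotationEnergy_le`), and `L_z` is symmetric on `X` (`integral_Lz_mul_conj_symm`).

Now let `φ` have mass `m` and be an action ground state for `ω`. Comparing the actions of `φ` and
of the minimizers for `ω'` at both frequencies shows that the mass is monotone in the frequency
(`mul_norm_sq_le_of_minimizers`), so `m` lies on one side of all masses at `ω'`. As `m` is in the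
interval spanned by those masses, it is their infimum or supremum, that is, a limit of masses at
`ω'`. Then `S_ω'(φ)` is at most the limit of minimal values of `S_ω'` (`minimizer_of_approx`), so
`φ` is an action ground state for `ω'` and `m` is attained, which is excluded.
-/

namespace RNLS

open Topology
open scoped FourierTransform SchwartzMap LineDeriv ComplexConjugate

/-! ### Weak partial derivatives -/

section

variable {d : ℕ}

open scoped ContDiff in
theorem ae_eq_zero_of_forall_schwartz {f : Space d → ℂ} (hf : LocallyIntegrable f)
    (h : ∀ u : 𝓢(Space d, ℂ), HasCompactSupport u → ∫ x, u x * f x = 0) : f =ᵐ[volume] 0 := by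
  refine ae_eq_zero_of_integral_contDiff_smul_eq_zero hf fun g hg hgc ↦ ?_
  have h1 : HasCompactSupport (Complex.ofRealCLM ∘ g) := hgc.comp_left rfl
  have h2 : ContDiff ℝ ∞ (Complex.ofRealCLM ∘ g) := by fun_prop
  simpa using h (h1.toSchwartzMap h2) h1

theorem isWeakPartial_iff {i : Fin d} {φ g : L2 d} :
    IsWeakPartial i φ g ↔ ∀ u : 𝓢(Space d, ℂ),
      -∫ x, (∂_{(EuclideanSpace.single i (1 : ℝ) : Space d)} u) x * φ x = ∫ x, u x * g x := by
  constructor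
  · intro h u
    have := congrArg (fun T ↦ T u) h
    simpa [integral_neg] using this
  · intro h
    ext u
    simpa [integral_neg] using h u

theorem IsWeakPartial.add {i : Fin d} {φ ψ g h : L2 d} (hφ : IsWeakPartial i φ g)
    (hψ : IsWeakPartial i ψ h) : IsWeakPartial i (φ + ψ) (g + h) := by
  have := congrArg₂ (· + ·) hφ hψ
  rw [← LineDeriv.lineDerivOp_add] at this
  simp only [← Lp.toTemperedDistributionCLM_apply, ← map_add] at this
  exact this

theorem IsWeakPartial.smul {i : Fin d} {φ g : L2 d} (c : ℂ) (hφ : IsWeakPartial i φ g) :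
    IsWeakPartial i (c • φ) (c • g) := by
  have : c • _ = c • _ := congrArg (c • ·) hφ
  rw [← LineDeriv.lineDerivOp_smul] at this
  simp only [← Lp.toTemperedDistributionCLM_apply, ← map_smul] at this
  exact this

/-- Weak partial derivatives are closed operators in `L²`. -/
theorem IsWeakPartial.of_tendsto {i : Fin d} {u v : ℕ → L2 d} {φ g : L2 d}
    (h : ∀ n, IsWeakPartial i (u n) (v n)) (hu : Tendsto u atTop (𝓝 φ))
    (hv : Tendsto v atTop (𝓝 g)) : IsWeakPartial i φ g := by
  have hc := (Lp.toTemperedDistributionCLM ℂ (volume : Measure (Space d)) 2).continuous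
  have h1 := (hc.tendsto φ).comp hu
  have h2 := (hc.tendsto g).comp hv
  have h3 := ((LineDeriv.continuous_lineDerivOp (EuclideanSpace.single i (1 : ℝ) : Space d)).tendsto
    (Lp.toTemperedDistributionCLM ℂ (volume : Measure (Space d)) 2 φ)).comp h1
  refine tendsto_nhds_unique h3 (h2.congr fun n ↦ (h n).symm)

theorem isWeakPartial_weakPartial {i : Fin d} {φ : L2 d} (h : ∃ g, IsWeakPartial i φ g) :
    IsWeakPartial i φ (weakPartial i φ) := by
  obtain ⟨g, hg⟩ := h
  rwa [weakPartial_eq hg]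

/-- The Fourier transform turns `∂_i` into multiplication by `2πiξ_i`. -/
theorem IsWeakPartial.fourier_ae {i : Fin d} {φ g : L2 d} (h : IsWeakPartial i φ g) :
    ∀ᵐ ξ, (𝓕 g : L2 d) ξ = (2 * Real.pi * Complex.I) * (ξ i : ℂ) * (𝓕 φ : L2 d) ξ := by
  have h1 := congrArg (fun T ↦ 𝓕 T) h
  simp only [TemperedDistribution.fourier_lineDerivOp_eq, Lp.fourier_toTemperedDistribution_eq]
    at h1
  have hl1 : LocallyIntegrable (𝓕 φ : L2 d) := (Lp.memLp _).locallyIntegrable (by norm_num)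
  have hl2 : LocallyIntegrable (𝓕 g : L2 d) := (Lp.memLp _).locallyIntegrable (by norm_num)
  have hcont : Continuous fun ξ : Space d ↦ (2 * Real.pi * Complex.I) * (ξ i : ℂ) := by fun_prop
  have hl3 : LocallyIntegrable
      (fun ξ ↦ (2 * Real.pi * Complex.I) * (ξ i : ℂ) * (𝓕 φ : L2 d) ξ) := by
    rw [← locallyIntegrableOn_univ] at hl1 ⊢
    exact hl1.continuousOn_mul hcont.continuousOn isOpen_univ.isLocallyClosed
  have key := ae_eq_zero_of_forall_schwartz (hl2.sub hl3) fun u hu ↦ ?_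
  · filter_upwards [key] with ξ hξ
    simpa [sub_eq_zero] using hξ
  have h2 := congrArg (fun T ↦ T u) h1
  change (2 * Real.pi * Complex.I) * TemperedDistribution.smulLeftCLM ℂ _ _ u = _ at h2
  simp only [TemperedDistribution.smulLeftCLM_apply_apply, Lp.toTemperedDistribution_apply,
    smul_eq_mul] at h2
  have hi1 : Integrable (fun ξ ↦ u ξ * (𝓕 g : L2 d) ξ) := by
    simpa using hl2.integrable_smul_left_of_hasCompactSupport u.continuous hu
  have hi2 : Integrable
      (fun ξ ↦ u ξ * ((2 * Real.pi * Complex.I) * (ξ i : ℂ) * (𝓕 φ : L2 d) ξ)) := by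
    simpa using hl3.integrable_smul_left_of_hasCompactSupport u.continuous hu
  simp only [Pi.sub_apply, mul_sub]
  rw [integral_sub hi1 hi2, ← h2, sub_eq_zero, ← integral_const_mul]
  refine integral_congr_ae (.of_forall fun ξ ↦ ?_)
  have :
      (fun x : Space d ↦ ((inner ℝ x (EuclideanSpace.single i (1 : ℝ)) : ℝ) : ℂ)).HasTemperateGrowth := by
    fun_prop
  simp only [SchwartzMap.smulLeftCLM_apply_apply this]
  simp [EuclideanSpace.inner_single_right]
  ring

/-- Weak partial derivatives are skew-symmetric; this is Plancherel, as the symbol `2πiξ_i` is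
imaginary. -/
theorem IsWeakPartial.inner_eq {i : Fin d} {φ g ψ h : L2 d} (hφ : IsWeakPartial i φ g)
    (hψ : IsWeakPartial i ψ h) : inner ℂ g ψ = -inner ℂ φ h := by
  rw [← Lp.inner_fourier_eq g ψ, ← Lp.inner_fourier_eq φ h, L2.inner_def, L2.inner_def,
    ← integral_neg]
  refine integral_congr_ae ?_
  filter_upwards [hφ.fourier_ae, hψ.fourier_ae] with ξ h1 h2
  rw [h1, h2]
  simp [Complex.conj_ofNat]
  ring

/-- Product rule for a weak derivative and a smooth real multiplier. -/
theorem IsWeakPartial.mul {i : Fin d} {φ g f f' : L2 d} (h : IsWeakPartial i φ g)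
    {m m' : Space d → ℝ} (hm : (fun x ↦ (m x : ℂ)).HasTemperateGrowth)
    (hm' : ∀ x, HasLineDerivAt ℝ (fun x ↦ (m x : ℂ)) (m' x : ℂ) x (EuclideanSpace.single i 1))
    (hf : f =ᵐ[volume] fun x ↦ (m x : ℂ) * φ x)
    (hf' : f' =ᵐ[volume] fun x ↦ (m x : ℂ) * g x + (m' x : ℂ) * φ x) : IsWeakPartial i f f' := by
  rw [isWeakPartial_iff] at h ⊢
  intro u
  have hint : ∀ (w : 𝓢(Space d, ℂ)) (ψ : L2 d), Integrable (fun x ↦ w x * ψ x) := fun w ψ ↦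
    (w.memLp 2).integrable_mul (Lp.memLp ψ)
  have hw := h (SchwartzMap.smulLeftCLM ℂ (fun x ↦ (m x : ℂ)) u)
  have hd : ∀ x, (∂_{(EuclideanSpace.single i (1 : ℝ) : Space d)}
      (SchwartzMap.smulLeftCLM ℂ (fun x ↦ (m x : ℂ)) u)) x =
      (m' x : ℂ) * u x +
        (m x : ℂ) * (∂_{(EuclideanSpace.single i (1 : ℝ) : Space d)} u) x := by
    intro x
    rw [SchwartzMap.lineDerivOp_apply, SchwartzMap.lineDerivOp_apply]
    have e : (⇑(SchwartzMap.smulLeftCLM ℂ (fun x ↦ (m x : ℂ)) u) : Space d → ℂ) =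
        fun x ↦ (m x : ℂ) * u x := by
      ext x
      simp [SchwartzMap.smulLeftCLM_apply_apply hm]
    rw [e]
    have h2 : HasLineDerivAt ℝ u (lineDeriv ℝ u x (EuclideanSpace.single i 1)) x
        (EuclideanSpace.single i 1) :=
      (u.differentiableAt.lineDifferentiableAt).hasLineDerivAt
    have := HasDerivAt.mul (hm' x) h2
    simp only [zero_smul, add_zero] at this
    exact HasLineDerivAt.lineDeriv this
  have i1 := hint (∂_{(EuclideanSpace.single i (1 : ℝ) : Space d)} u) f
  have i2 := hint u f'
  have i3 := hint (∂_{(EuclideanSpace.single i (1 : ℝ) : Space d)}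
      (SchwartzMap.smulLeftCLM ℂ (fun x ↦ (m x : ℂ)) u)) φ
  have i4 := hint (SchwartzMap.smulLeftCLM ℂ (fun x ↦ (m x : ℂ)) u) g
  rw [neg_eq_iff_add_eq_zero] at hw ⊢
  rw [← integral_add i3 i4] at hw
  rw [← integral_add i1 i2, ← hw]
  refine integral_congr_ae ?_
  filter_upwards [hf, hf'] with x h1 h2
  rw [hd, h1, h2, SchwartzMap.smulLeftCLM_apply_apply hm, smul_eq_mul]
  ring

/-- `x_k (1 + ε²|x|²)⁻¹`, a smooth truncation of the coordinate `x_k`: it is bounded for `ε > 0`,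
and its derivatives in the other directions are bounded uniformly in `ε`. -/
noncomputable def coordCutoff (k : Fin d) (ε : ℝ) (x : Space d) : ℝ :=
  x k * (1 + ‖ε • x‖ ^ 2) ^ (-1 : ℝ)

theorem coordCutoff_eq (k : Fin d) (ε : ℝ) (x : Space d) :
    coordCutoff k ε x = x k / (1 + ε ^ 2 * ‖x‖ ^ 2) := by
  rw [coordCutoff, Real.rpow_neg_one, norm_smul, mul_pow, Real.norm_eq_abs, sq_abs, div_eq_mul_inv]

theorem coordCutoff_hasTemperateGrowth (k : Fin d) (ε : ℝ) :
    (fun x ↦ (coordCutoff k ε x : ℂ)).HasTemperateGrowth := by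
  have h1 :
      (fun x : Space d ↦ ((inner ℝ x (EuclideanSpace.single k (1 : ℝ)) : ℝ) : ℂ)).HasTemperateGrowth := by
    fun_prop
  have h2 : (fun x : Space d ↦ ((1 + ‖x‖ ^ 2) ^ (-1 : ℝ) : ℝ)).HasTemperateGrowth := by
    fun_prop
  have h3 : (fun x : Space d ↦ ε • x).HasTemperateGrowth := by fun_prop
  have h5 : (fun x : Space d ↦ (((1 + ‖ε • x‖ ^ 2) ^ (-1 : ℝ) : ℝ) : ℂ)).HasTemperateGrowth :=
    Function.HasTemperateGrowth.comp Function.Complex.hasTemperateGrowth_ofReal (h2.comp h3)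
  convert! h1.mul h5 using 1
  ext x
  simp [coordCutoff, EuclideanSpace.inner_single_right]

theorem norm_sq_add_smul_single (x : Space d) (i : Fin d) (t : ℝ) :
    ‖x + t • (EuclideanSpace.single i (1 : ℝ) : Space d)‖ ^ 2 = ‖x‖ ^ 2 + 2 * t * x i + t ^ 2 := by
  rw [norm_add_sq_real, norm_smul, inner_smul_right, EuclideanSpace.inner_single_right]
  simp
  ring

theorem coordCutoff_hasLineDerivAt {k i : Fin d} (hki : k ≠ i) (ε : ℝ) (x : Space d) :
    HasLineDerivAt ℝ (fun x ↦ (coordCutoff k ε x : ℂ))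
      ((-(2 * ε ^ 2 * x k * x i) / (1 + ε ^ 2 * ‖x‖ ^ 2) ^ 2 : ℝ) : ℂ) x
      (EuclideanSpace.single i 1) := by
  refine HasDerivAt.ofReal_comp ?_
  simp only [coordCutoff_eq, norm_sq_add_smul_single]
  have e : ∀ t : ℝ, (x + t • (EuclideanSpace.single i (1 : ℝ) : Space d)) k = x k := by
    intro t
    simp [hki]
  simp only [e]
  have h0 : (1 + ε ^ 2 * (‖x‖ ^ 2 + 2 * 0 * x i + 0 ^ 2)) ≠ 0 := by
    norm_num
    positivity
  have h1 : HasDerivAt (fun t : ℝ ↦ 1 + ε ^ 2 * (‖x‖ ^ 2 + 2 * t * x i + t ^ 2))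
      (ε ^ 2 * (2 * x i)) 0 := by
    have a1 : HasDerivAt (fun t : ℝ ↦ 2 * t * x i) (2 * 1 * x i) 0 :=
      ((hasDerivAt_id 0).const_mul 2).mul_const _
    have a2 : HasDerivAt (fun t : ℝ ↦ t ^ 2) 0 0 := by simpa using hasDerivAt_pow 2 (0 : ℝ)
    convert! (((a1.const_add (‖x‖ ^ 2)).add a2).const_mul (ε ^ 2)).const_add 1 using 1
    ring
  have h2 := (hasDerivAt_const (0 : ℝ) (x k)).div h1 h0
  convert! h2 using 1
  simp
  ring

theorem abs_coordCutoff_le (k : Fin d) (ε : ℝ) (x : Space d) : |coordCutoff k ε x| ≤ |x k| := by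
  rw [coordCutoff_eq, abs_div, abs_of_pos (by positivity : 0 < 1 + ε ^ 2 * ‖x‖ ^ 2)]
  exact div_le_self (abs_nonneg _) (by nlinarith [sq_nonneg (ε * ‖x‖)])

theorem abs_coordCutoff_le_inv (k : Fin d) {ε : ℝ} (hε : 0 < ε) (x : Space d) :
    |coordCutoff k ε x| ≤ ε⁻¹ := by
  rw [coordCutoff_eq, abs_div, abs_of_pos (by positivity : 0 < 1 + ε ^ 2 * ‖x‖ ^ 2),
    div_le_iff₀ (by positivity), ← div_eq_inv_mul, le_div_iff₀ hε]
  have : |x k| ≤ ‖x‖ := by simpa using PiLp.norm_apply_le x k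
  nlinarith [sq_nonneg (ε * ‖x‖ - 1), mul_le_mul_of_nonneg_right this hε.le, abs_nonneg (x k)]

theorem abs_coordCutoff_deriv_le (k i : Fin d) (ε : ℝ) (x : Space d) :
    |-(2 * ε ^ 2 * x k * x i) / (1 + ε ^ 2 * ‖x‖ ^ 2) ^ 2| ≤ 1 := by
  have h1 : |x k| ≤ ‖x‖ := by simpa using PiLp.norm_apply_le x k
  have h2 : |x i| ≤ ‖x‖ := by simpa using PiLp.norm_apply_le x i
  rw [abs_div, abs_neg, abs_mul, abs_mul,
    abs_of_pos (by positivity : 0 < (1 + ε ^ 2 * ‖x‖ ^ 2) ^ 2),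
    div_le_one (by positivity), abs_of_nonneg (by positivity : 0 ≤ 2 * ε ^ 2)]
  have h3 : |x k| * |x i| ≤ ‖x‖ * ‖x‖ := mul_le_mul h1 h2 (abs_nonneg _) (norm_nonneg _)
  have h4 := mul_le_mul_of_nonneg_left h3 (by positivity : 0 ≤ 2 * ε ^ 2)
  nlinarith [sq_nonneg (ε ^ 2 * ‖x‖ ^ 2)]

theorem tendsto_coordCutoff (k : Fin d) (x : Space d) {ε : ℕ → ℝ} (hε : Tendsto ε atTop (𝓝 0)) :
    Tendsto (fun n ↦ coordCutoff k (ε n) x) atTop (𝓝 (x k)) := by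
  simp only [coordCutoff_eq]
  have : Tendsto (fun n ↦ x k / (1 + ε n ^ 2 * ‖x‖ ^ 2)) atTop
      (𝓝 (x k / (1 + 0 ^ 2 * ‖x‖ ^ 2))) :=
    tendsto_const_nhds.div ((((hε.pow 2).mul_const _)).const_add 1) (by simp)
  simpa using this

theorem tendsto_coordCutoff_deriv (k i : Fin d) (x : Space d) {ε : ℕ → ℝ}
    (hε : Tendsto ε atTop (𝓝 0)) :
    Tendsto (fun n ↦ -(2 * ε n ^ 2 * x k * x i) / (1 + ε n ^ 2 * ‖x‖ ^ 2) ^ 2) atTop (𝓝 0) := by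
  have : Tendsto (fun n ↦ -(2 * ε n ^ 2 * x k * x i) / (1 + ε n ^ 2 * ‖x‖ ^ 2) ^ 2) atTop
      (𝓝 (-(2 * 0 ^ 2 * x k * x i) / (1 + 0 ^ 2 * ‖x‖ ^ 2) ^ 2)) :=
    ((((hε.pow 2).const_mul 2).mul_const _).mul_const _).neg.div
      (((((hε.pow 2).mul_const _)).const_add 1).pow 2) (by simp)
  simpa using this

/-- Integration by parts with a weight `x_k` that is constant in direction `i`. The weight is
truncated by `coordCutoff`, because `x_k ∂_i φ` need not be in `L²`. -/
theorem IsWeakPartial.integral_coord_mul {k i : Fin d} (hki : k ≠ i) {φ g ψ h : L2 d}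
    (hφ : IsWeakPartial i φ g) (hψ : IsWeakPartial i ψ h)
    (hkφ : MemLp (fun x ↦ (x k : ℂ) * φ x) 2) (hkψ : MemLp (fun x ↦ (x k : ℂ) * ψ x) 2) :
    ∫ x, conj (g x) * ((x k : ℂ) * ψ x) = -∫ x, conj ((x k : ℂ) * φ x) * h x := by
  set m' : ℝ → Space d → ℝ := fun ε x ↦ -(2 * ε ^ 2 * x k * x i) / (1 + ε ^ 2 * ‖x‖ ^ 2) ^ 2
  have hm'c : ∀ ε, Continuous (m' ε) := fun ε ↦ by
    refine Continuous.div (by fun_prop) (by fun_prop) fun x ↦ by positivity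
  have hmc : ∀ ε, Continuous (coordCutoff k ε : Space d → ℝ) := fun ε ↦ by
    simp only [funext (coordCutoff_eq k ε)]
    refine Continuous.div (by fun_prop) (by fun_prop) fun x ↦ by positivity
  have key : ∀ ε : ℝ, 0 < ε → ∫ x, conj ((coordCutoff k ε x : ℂ) * g x + (m' ε x : ℂ) * φ x) * ψ x
      = -∫ x, conj ((coordCutoff k ε x : ℂ) * φ x) * h x := by
    intro ε hε
    have b : ∀ w : L2 d, MemLp (fun x ↦ (coordCutoff k ε x : ℂ) * w x) 2 := fun w ↦ by
      refine (Lp.memLp w).of_le_mul (c := ε⁻¹) ?_ (.of_forall fun x ↦ ?_)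
      · exact (Complex.continuous_ofReal.comp (hmc ε)).aestronglyMeasurable.mul
          (Lp.aestronglyMeasurable w)
      · rw [norm_mul]
        gcongr
        simpa using abs_coordCutoff_le_inv k hε x
    have b' : MemLp (fun x ↦ (m' ε x : ℂ) * φ x) 2 := by
      refine (Lp.memLp φ).of_le_mul (c := 1) ?_ (.of_forall fun x ↦ ?_)
      · exact (Complex.continuous_ofReal.comp (hm'c ε)).aestronglyMeasurable.mul
          (Lp.aestronglyMeasurable φ)
      · rw [norm_mul]
        gcongr
        simpa using abs_coordCutoff_deriv_le k i ε x
    have hw := hφ.mul (coordCutoff_hasTemperateGrowth k ε) (coordCutoff_hasLineDerivAt hki ε)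
      (f := (b φ).toLp _) (f' := ((b g).add b').toLp _) (MemLp.coeFn_toLp _) (MemLp.coeFn_toLp _)
    have := hw.inner_eq hψ
    rw [L2.inner_def, L2.inner_def] at this
    convert this using 1
    · refine integral_congr_ae ?_
      filter_upwards [MemLp.coeFn_toLp ((b g).add b')] with x hx
      rw [hx]
      simp [m', mul_comm]
    · congr 1
      refine integral_congr_ae ?_
      filter_upwards [MemLp.coeFn_toLp (b φ)] with x hx
      rw [hx]
      simp [mul_comm]
  have hε : Tendsto (fun n : ℕ ↦ 1 / ((n : ℝ) + 1)) atTop (𝓝 0) :=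
    tendsto_one_div_add_atTop_nhds_zero_nat
  have cg := Complex.continuous_conj
  have l1 : Tendsto (fun n : ℕ ↦ ∫ x, conj ((coordCutoff k (1 / ((n : ℝ) + 1)) x : ℂ) * g x +
      (m' (1 / ((n : ℝ) + 1)) x : ℂ) * φ x) * ψ x) atTop
      (𝓝 (∫ x, conj (g x) * ((x k : ℂ) * ψ x))) := by
    refine tendsto_integral_of_dominated_convergence
      (fun x ↦ ‖g x * ((x k : ℂ) * ψ x)‖ + ‖φ x * ψ x‖) ?_ ?_ ?_ ?_
    · intro n
      refine (cg.comp_aestronglyMeasurable ?_).mul (Lp.aestronglyMeasurable ψ)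
      exact ((Complex.continuous_ofReal.comp (hmc _)).aestronglyMeasurable.mul
          (Lp.aestronglyMeasurable g)).add
        ((Complex.continuous_ofReal.comp (hm'c _)).aestronglyMeasurable.mul
          (Lp.aestronglyMeasurable φ))
    · exact ((Lp.memLp g).integrable_mul hkψ).norm.add
        ((Lp.memLp φ).integrable_mul (Lp.memLp ψ)).norm
    · intro n
      refine .of_forall fun x ↦ ?_
      rw [norm_mul, RCLike.norm_conj]
      have e1 := abs_coordCutoff_le k (1 / ((n : ℝ) + 1)) x
      have e2 := abs_coordCutoff_deriv_le k i (1 / ((n : ℝ) + 1)) x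
      calc _ ≤ (‖(coordCutoff k (1 / ((n : ℝ) + 1)) x : ℂ) * g x‖ +
            ‖(m' (1 / ((n : ℝ) + 1)) x : ℂ) * φ x‖) * ‖ψ x‖ := by gcongr; exact norm_add_le _ _
        _ ≤ (|x k| * ‖g x‖ + 1 * ‖φ x‖) * ‖ψ x‖ := by
            simp only [norm_mul, Complex.norm_real, Real.norm_eq_abs]
            gcongr
        _ = _ := by simp; ring
    · refine .of_forall fun x ↦ ?_
      have t1 : Tendsto (fun n : ℕ ↦ (coordCutoff k (1 / ((n : ℝ) + 1)) x : ℂ)) atTop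
          (𝓝 (x k : ℂ)) := (Complex.continuous_ofReal.tendsto _).comp (tendsto_coordCutoff k x hε)
      have t2 : Tendsto (fun n : ℕ ↦ (m' (1 / ((n : ℝ) + 1)) x : ℂ)) atTop
          (𝓝 ((0 : ℝ) : ℂ)) :=
        (Complex.continuous_ofReal.tendsto _).comp (tendsto_coordCutoff_deriv k i x hε)
      have t3 :=
        ((cg.tendsto _).comp ((t1.mul_const (g x)).add (t2.mul_const (φ x)))).mul_const (ψ x)
      rw [Complex.ofReal_zero, zero_mul, add_zero, map_mul, Complex.conj_ofReal,
        mul_comm (x k : ℂ), mul_assoc] at t3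
      exact t3
  have l2 : Tendsto (fun n : ℕ ↦ -∫ x, conj ((coordCutoff k (1 / ((n : ℝ) + 1)) x : ℂ) * φ x) * h x)
      atTop (𝓝 (-∫ x, conj ((x k : ℂ) * φ x) * h x)) := by
    refine (tendsto_integral_of_dominated_convergence
      (fun x ↦ ‖((x k : ℂ) * φ x) * h x‖) ?_ ?_ ?_ ?_).neg
    · intro n
      refine (cg.comp_aestronglyMeasurable ?_).mul (Lp.aestronglyMeasurable h)
      exact ((Complex.continuous_ofReal.comp (hmc _)).aestronglyMeasurable.mul
          (Lp.aestronglyMeasurable φ))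
    · exact (hkφ.integrable_mul (Lp.memLp h)).norm
    · intro n
      refine .of_forall fun x ↦ ?_
      have e1 := abs_coordCutoff_le k (1 / ((n : ℝ) + 1)) x
      rw [norm_mul, RCLike.norm_conj, norm_mul, norm_mul, norm_mul]
      gcongr
      simpa using e1
    · refine .of_forall fun x ↦ ?_
      have t1 : Tendsto (fun n : ℕ ↦ (coordCutoff k (1 / ((n : ℝ) + 1)) x : ℂ)) atTop
          (𝓝 (x k : ℂ)) := (Complex.continuous_ofReal.tendsto _).comp (tendsto_coordCutoff k x hε)
      exact ((cg.tendsto _).comp (t1.mul_const (φ x))).mul_const (h x)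
  refine tendsto_nhds_unique l1 (l2.congr fun n ↦ (key _ (by positivity)).symm)

end

/-! ### Frequency truncation -/

section

variable {d : ℕ}

theorem integral_norm_sq_eq (f : L2 d) : ∫ x, ‖f x‖ ^ 2 = ‖f‖ ^ 2 := by
  have h := L2.inner_def (𝕜 := ℂ) f f
  simp only [inner_self_eq_norm_sq_to_K] at h
  have h2 : ((‖f‖ ^ 2 : ℝ) : ℂ) = ((∫ x, ‖f x‖ ^ 2 : ℝ) : ℂ) := by
    rw [← integral_complex_ofReal]
    simpa using h
  exact (Complex.ofReal_injective h2).symm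

theorem integrable_norm_sq (f : L2 d) : Integrable fun x ↦ ‖f x‖ ^ 2 :=
  (Lp.memLp f).integrable_norm_pow (by norm_num)

/-- On `L¹ ∩ L²` the inverse Fourier transform of `L²` is given by the Fourier integral. -/
theorem fourierInv_ae_eq {g : L2 d} (hg : Integrable g) :
    (𝓕⁻ g : L2 d) =ᵐ[volume] 𝓕⁻ (g : Space d → ℂ) := by
  have hc : Continuous (𝓕⁻ (g : Space d → ℂ)) :=
    VectorFourier.fourierIntegral_continuous Real.continuous_fourierChar
      (by exact continuous_inner.neg) hg
  have hl1 : LocallyIntegrable (𝓕⁻ g : L2 d) := (Lp.memLp _).locallyIntegrable (by norm_num)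
  have hl2 : LocallyIntegrable (𝓕⁻ (g : Space d → ℂ)) := hc.locallyIntegrable
  have key := ae_eq_zero_of_forall_schwartz (hl1.sub hl2) fun u hu ↦ ?_
  · filter_upwards [key] with ξ hξ
    simpa [sub_eq_zero] using hξ
  have hi1 : Integrable (fun ξ ↦ u ξ * (𝓕⁻ g : L2 d) ξ) := by
    simpa using hl1.integrable_smul_left_of_hasCompactSupport u.continuous hu
  have hi2 : Integrable (fun ξ ↦ u ξ * (𝓕⁻ (g : Space d → ℂ)) ξ) := by
    simpa using hl2.integrable_smul_left_of_hasCompactSupport u.continuous hu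
  simp only [Pi.sub_apply, mul_sub]
  rw [integral_sub hi1 hi2, sub_eq_zero]
  have h1 := congrArg (fun T ↦ T u) (Lp.fourierInv_toTemperedDistribution_eq g)
  simp only [TemperedDistribution.fourierInv_apply, Lp.toTemperedDistribution_apply,
    smul_eq_mul] at h1
  rw [← h1]
  have h2 := VectorFourier.integral_fourierIntegral_smul_eq_flip (μ := volume) (ν := volume)
    (L := -innerₗ (Space d)) (f := u) (g := (g : Space d → ℂ)) Real.continuous_fourierChar
    (by exact continuous_inner.neg) u.integrable hg
  simp only [smul_eq_mul] at h2
  convert h2 using 1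
  · refine integral_congr_ae (.of_forall fun x ↦ ?_)
    simp only [SchwartzMap.fourierInv_coe]
    rfl
  · have : (-innerₗ (Space d)).flip = -innerₗ (Space d) := by
      ext x y
      simp [real_inner_comm]
    rw [this]
    rfl

theorem memLp_lowFreq (N : ℝ) (φ : L2 d) :
    MemLp ((Metric.closedBall (0 : Space d) N).indicator (𝓕 φ : L2 d)) 2 :=
  (Lp.memLp _).indicator measurableSet_closedBall

theorem integrable_lowFreq (N : ℝ) (φ : L2 d) :
    Integrable ((Metric.closedBall (0 : Space d) N).indicator (𝓕 φ : L2 d)) := by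
  rw [integrable_indicator_iff measurableSet_closedBall]
  have := isCompact_closedBall (0 : Space d) N
  exact ((Lp.memLp _).locallyIntegrable (by norm_num)).integrableOn_isCompact this

/-- The part of `φ` with frequencies `|ξ| ≤ N`, as a function defined everywhere. -/
noncomputable def lowpass (N : ℝ) (φ : L2 d) : Space d → ℂ :=
  𝓕⁻ ((Metric.closedBall (0 : Space d) N).indicator (𝓕 φ : L2 d))

/-- The part of `φ` with frequencies `|ξ| ≤ N`, as an element of `L²`. -/
noncomputable def lowpassL2 (N : ℝ) (φ : L2 d) : L2 d :=
  𝓕⁻ ((memLp_lowFreq N φ).toLp _)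

theorem lowpassL2_ae_eq (N : ℝ) (φ : L2 d) : lowpassL2 N φ =ᵐ[volume] lowpass N φ := by
  have h := MemLp.coeFn_toLp (memLp_lowFreq N φ)
  have h1 : Integrable ((memLp_lowFreq N φ).toLp _ : Space d → ℂ) :=
    (integrable_lowFreq N φ).congr h.symm
  refine (fourierInv_ae_eq h1).trans (.of_forall fun x ↦ ?_)
  simp only [lowpass, Real.fourierInv_eq]
  refine integral_congr_ae ?_
  filter_upwards [h] with y hy
  rw [hy]

theorem exists_lowpass_eq_inner (N : ℝ) (x : Space d) :
    ∃ e : L2 d, ∀ φ, lowpass N φ x = inner ℂ e φ := by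
  have hm : MemLp ((Metric.closedBall (0 : Space d) N).indicator
      fun ξ ↦ conj (Real.fourierChar (inner ℝ ξ x) : ℂ)) 2 := by
    refine memLp_indicator_iff_restrict measurableSet_closedBall |>.mpr ?_
    have : IsFiniteMeasure (volume.restrict (Metric.closedBall (0 : Space d) N)) :=
      ⟨by simpa using measure_closedBall_lt_top⟩
    refine MemLp.of_bound (C := 1) ?_ (.of_forall fun ξ ↦ by simp [Circle.norm_coe])
    refine Continuous.aestronglyMeasurable ?_
    refine Complex.continuous_conj.comp (continuous_subtype_val.comp
      (Real.continuous_fourierChar.comp (by fun_prop)))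
  refine ⟨𝓕⁻ (hm.toLp _), fun φ ↦ ?_⟩
  rw [← Lp.inner_fourier_eq, FourierTransform.fourier_fourierInv_eq, L2.inner_def, lowpass,
    Real.fourierInv_eq]
  refine integral_congr_ae ?_
  filter_upwards [hm.coeFn_toLp] with ξ hξ
  rw [hξ]
  by_cases hb : ξ ∈ Metric.closedBall (0 : Space d) N
  · simp [Set.indicator_of_mem hb, Circle.smul_def, mul_comm]
  · simp [Set.indicator_of_notMem hb]

theorem ae_sum_norm_fourier_sq {φ : L2 d} {g : Fin d → L2 d} (h : ∀ i, IsWeakPartial i φ (g i)) :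
    ∀ᵐ ξ, ∑ i, ‖(𝓕 (g i) : L2 d) ξ‖ ^ 2 = (2 * Real.pi) ^ 2 * (‖ξ‖ ^ 2 * ‖(𝓕 φ : L2 d) ξ‖ ^ 2) := by
  filter_upwards [ae_all_iff.mpr fun i ↦ (h i).fourier_ae] with ξ hξ
  rw [EuclideanSpace.norm_sq_eq, Finset.sum_mul, Finset.mul_sum]
  refine Finset.sum_congr rfl fun i _ ↦ ?_
  rw [hξ i]
  simp only [norm_mul, Complex.norm_real, Complex.norm_I, Complex.norm_ofNat, mul_one, mul_pow,
    Real.norm_eq_abs, sq_abs]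
  ring

theorem ae_norm_sq_mul_le {φ : L2 d} {g : Fin d → L2 d} (h : ∀ i, IsWeakPartial i φ (g i)) :
    ∀ᵐ ξ, ‖ξ‖ ^ 2 * ‖(𝓕 φ : L2 d) ξ‖ ^ 2 ≤ ∑ i, ‖(𝓕 (g i) : L2 d) ξ‖ ^ 2 := by
  filter_upwards [ae_sum_norm_fourier_sq h] with ξ hξ
  rw [hξ]
  have : 1 ≤ (2 * Real.pi) ^ 2 := by nlinarith [Real.pi_gt_three]
  have h2 : 0 ≤ ‖ξ‖ ^ 2 * ‖(𝓕 φ : L2 d) ξ‖ ^ 2 := by positivity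
  nlinarith

theorem integrable_sum_norm_fourier_sq (g : Fin d → L2 d) :
    Integrable fun ξ ↦ ∑ i, ‖(𝓕 (g i) : L2 d) ξ‖ ^ 2 :=
  integrable_finsetSum _ fun _ _ ↦ integrable_norm_sq _

theorem integral_sum_norm_fourier_sq (g : Fin d → L2 d) :
    ∫ ξ, ∑ i, ‖(𝓕 (g i) : L2 d) ξ‖ ^ 2 = ∑ i, ‖g i‖ ^ 2 := by
  rw [integral_finsetSum _ fun _ _ ↦ integrable_norm_sq _]
  simp [integral_norm_sq_eq]

/-- The frequencies `|ξ| > N` of an `H¹` function are small in `L²`. -/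
theorem norm_sub_lowpass_le {φ : L2 d} {g : Fin d → L2 d} (h : ∀ i, IsWeakPartial i φ (g i))
    {N : ℝ} (hN : 0 ≤ N) : N ^ 2 * ‖φ - lowpassL2 N φ‖ ^ 2 ≤ ∑ i, ‖g i‖ ^ 2 := by
  rw [← Lp.norm_fourier_eq (φ - lowpassL2 N φ), ← integral_norm_sq_eq,
    ← integral_sum_norm_fourier_sq, ← integral_const_mul]
  refine integral_mono_ae ((integrable_norm_sq _).const_mul _)
    (integrable_sum_norm_fourier_sq g) ?_
  have e : (𝓕 (φ - lowpassL2 N φ) : L2 d) = 𝓕 φ - (memLp_lowFreq N φ).toLp _ := by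
    refine (map_sub (Lp.fourierTransformₗᵢ (Space d) ℂ) _ _).trans ?_
    exact congrArg ((𝓕 φ : L2 d) - ·)
      ((Lp.fourierTransformₗᵢ (Space d) ℂ).apply_symm_apply ((memLp_lowFreq N φ).toLp _))
  rw [e]
  filter_upwards [ae_norm_sq_mul_le h, Lp.coeFn_sub (𝓕 φ : L2 d) ((memLp_lowFreq N φ).toLp _),
    (memLp_lowFreq N φ).coeFn_toLp] with ξ h1 h2 h3
  simp only [h2, Pi.sub_apply, h3]
  by_cases hb : ξ ∈ Metric.closedBall (0 : Space d) N
  · rw [Set.indicator_of_mem hb]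
    simp only [sub_self, norm_zero, ne_eq, OfNat.ofNat_ne_zero, not_false_eq_true, zero_pow,
      mul_zero]
    positivity
  · rw [Set.indicator_of_notMem hb, sub_zero]
    refine le_trans ?_ h1
    have : N ≤ ‖ξ‖ := by
      simp at hb
      exact hb.le
    gcongr

/-- Pointwise bound for the low frequencies of an `H¹` function: for `2 (1 + r) > d` they grow at
most like `N ^ r`. -/
theorem exists_norm_lowpass_le {r : ℝ} (hr : 0 ≤ r) (hd : (d : ℝ) < 2 * (1 + r)) :
    ∃ K : ℝ, 0 < K ∧ ∀ (φ : L2 d) (g : Fin d → L2 d), (∀ i, IsWeakPartial i φ (g i)) →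
      ∀ (N : ℝ) (x : Space d), 0 ≤ N → ‖lowpass N φ x‖ ≤
        K * (1 + N ^ 2) ^ (r / 2) * √(‖φ‖ ^ 2 + ∑ i, ‖g i‖ ^ 2) := by
  have hI : Integrable fun ξ : Space d ↦ (1 + ‖ξ‖ ^ 2) ^ (-(2 * (1 + r)) / 2) :=
    integrable_rpow_neg_one_add_norm_sq (by simpa using hd)
  set K := √(∫ ξ : Space d, (1 + ‖ξ‖ ^ 2) ^ (-(2 * (1 + r)) / 2))
  refine ⟨K + 1, by positivity, fun φ g h N x hN ↦ ?_⟩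
  set a : Space d → ℝ := fun ξ ↦ (1 + ‖ξ‖ ^ 2) ^ (-(1 + r) / 2)
  set b : Space d → ℝ := fun ξ ↦ √(1 + ‖ξ‖ ^ 2) * ‖(𝓕 φ : L2 d) ξ‖
  have ha : ∀ ξ, a ξ ^ 2 = (1 + ‖ξ‖ ^ 2) ^ (-(2 * (1 + r)) / 2) := fun ξ ↦ by
    simp only [a]
    rw [← Real.rpow_mul_natCast (by positivity)]
    congr 1
    push_cast
    ring
  have hb : ∀ ξ, b ξ ^ 2 = ‖(𝓕 φ : L2 d) ξ‖ ^ 2 + ‖ξ‖ ^ 2 * ‖(𝓕 φ : L2 d) ξ‖ ^ 2 := fun ξ ↦ by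
    simp only [b]
    rw [mul_pow, Real.sq_sqrt (by positivity)]
    ring
  have hac : Continuous a := by
    refine Continuous.rpow_const (by fun_prop) fun ξ ↦ Or.inl (by positivity)
  have hbm : AEStronglyMeasurable b :=
    (by fun_prop : Continuous fun ξ : Space d ↦ √(1 + ‖ξ‖ ^ 2)).aestronglyMeasurable.mul
      (Lp.aestronglyMeasurable _).norm
  have hdom : Integrable fun ξ ↦ ‖(𝓕 φ : L2 d) ξ‖ ^ 2 + ∑ i, ‖(𝓕 (g i) : L2 d) ξ‖ ^ 2 :=
    (integrable_norm_sq _).add (integrable_sum_norm_fourier_sq g)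
  have hb_le : ∀ᵐ ξ, b ξ ^ 2 ≤ ‖(𝓕 φ : L2 d) ξ‖ ^ 2 + ∑ i, ‖(𝓕 (g i) : L2 d) ξ‖ ^ 2 := by
    filter_upwards [ae_norm_sq_mul_le h] with ξ hξ
    rw [hb]
    gcongr
  have hb_int : Integrable fun ξ ↦ b ξ ^ 2 := by
    refine hdom.mono' (hbm.pow 2) ?_
    filter_upwards [hb_le] with ξ hξ
    rwa [Real.norm_of_nonneg (by positivity)]
  have hb_bound : ∫ ξ, b ξ ^ 2 ≤ ‖φ‖ ^ 2 + ∑ i, ‖g i‖ ^ 2 := by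
    calc _ ≤ ∫ ξ, (‖(𝓕 φ : L2 d) ξ‖ ^ 2 + ∑ i, ‖(𝓕 (g i) : L2 d) ξ‖ ^ 2) :=
          integral_mono_ae hb_int hdom hb_le
      _ = _ := by
          rw [integral_add (integrable_norm_sq _) (integrable_sum_norm_fourier_sq g),
            integral_sum_norm_fourier_sq, integral_norm_sq_eq, Lp.norm_fourier_eq]
  have ha_mem : MemLp a 2 := by
    rw [memLp_two_iff_integrable_sq hac.aestronglyMeasurable]
    simpa only [ha] using hI
  have hb_mem : MemLp b 2 := by
    rw [memLp_two_iff_integrable_sq hbm]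
    exact hb_int
  have hab_int : Integrable fun ξ ↦ a ξ * b ξ := ha_mem.integrable_mul hb_mem
  have hCS : ∫ ξ, a ξ * b ξ ≤ √(∫ ξ, a ξ ^ 2) * √(∫ ξ, b ξ ^ 2) := by
    have := integral_mul_le_Lp_mul_Lq_of_nonneg (μ := volume) (f := a) (g := b)
      Real.HolderConjugate.two_two (.of_forall fun ξ ↦ by positivity)
      (.of_forall fun ξ ↦ by positivity) (by simpa using ha_mem) (by simpa using hb_mem)
    simpa [Real.sqrt_eq_rpow] using this
  have hpt : ∀ ξ, ‖(Metric.closedBall (0 : Space d) N).indicator (𝓕 φ : L2 d) ξ‖ ≤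
      (1 + N ^ 2) ^ (r / 2) * (a ξ * b ξ) := by
    intro ξ
    by_cases hm : ξ ∈ Metric.closedBall (0 : Space d) N
    · rw [Set.indicator_of_mem hm]
      have hξ : ‖ξ‖ ≤ N := by simpa using hm
      have e1 : (1 : ℝ) = (1 + ‖ξ‖ ^ 2) ^ (r / 2) * (a ξ * √(1 + ‖ξ‖ ^ 2)) := by
        simp only [a]
        rw [Real.sqrt_eq_rpow, ← Real.rpow_add (by positivity), ← Real.rpow_add (by positivity)]
        ring_nf
        simp
      calc ‖(𝓕 φ : L2 d) ξ‖ = 1 * ‖(𝓕 φ : L2 d) ξ‖ := (one_mul _).symm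
        _ = (1 + ‖ξ‖ ^ 2) ^ (r / 2) * (a ξ * b ξ) := by
            conv_lhs => rw [e1]
            simp only [b]
            ring
        _ ≤ _ := by gcongr
    · rw [Set.indicator_of_notMem hm, norm_zero]
      positivity
  calc ‖lowpass N φ x‖ ≤ ∫ ξ, ‖(Metric.closedBall (0 : Space d) N).indicator (𝓕 φ : L2 d) ξ‖ := by
        rw [lowpass, Real.fourierInv_eq]
        refine (norm_integral_le_integral_norm _).trans (le_of_eq ?_)
        simp [Circle.smul_def, Circle.norm_coe]
    _ ≤ ∫ ξ, (1 + N ^ 2) ^ (r / 2) * (a ξ * b ξ) :=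
        integral_mono (integrable_lowFreq N φ).norm (hab_int.const_mul _) hpt
    _ = (1 + N ^ 2) ^ (r / 2) * ∫ ξ, a ξ * b ξ := integral_const_mul _ _
    _ ≤ (1 + N ^ 2) ^ (r / 2) * (K * √(‖φ‖ ^ 2 + ∑ i, ‖g i‖ ^ 2)) := by
        gcongr
        refine hCS.trans ?_
        simp only [ha]
        gcongr
    _ ≤ _ := by
        rw [mul_comm (K + 1), mul_assoc]
        gcongr
        linarith

end

/-! ### The subcritical Sobolev embedding -/

section

variable {d : ℕ}

/-- Chebyshev's inequality in `L²`. -/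
theorem volume_le_norm_le (ψ : L2 d) {s : ℝ} (hs : 0 < s) :
    volume {x | s ≤ ‖ψ x‖} ≤ ENNReal.ofReal (‖ψ‖ ^ 2 / s ^ 2) := by
  have hset : {x | s ≤ ‖ψ x‖} = {x | s ^ 2 ≤ ‖ψ x‖ ^ 2} := by
    ext x
    exact (pow_le_pow_iff_left₀ hs.le (norm_nonneg _) two_ne_zero).symm
  have h1 := mul_meas_ge_le_integral_of_nonneg (μ := volume) (f := fun x ↦ ‖ψ x‖ ^ 2)
    (.of_forall fun x ↦ by positivity) (integrable_norm_sq ψ) (s ^ 2)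
  rw [integral_norm_sq_eq] at h1
  have hfin := (integrable_norm_sq ψ).measure_ge_lt_top (pow_pos hs 2)
  rw [hset, ← ENNReal.ofReal_toReal hfin.ne]
  refine ENNReal.ofReal_le_ofReal ?_
  rw [le_div_iff₀' (by positivity)]
  exact h1

/-- The distribution function of an `H¹` function decays like `t ^ (-2 - 2 / r)`: at height `t`,
the low frequencies `|ξ| ≤ N` with `N ∼ t ^ (1 / r)` are pointwise below `t / 2`, and the high
frequencies have `L²` norm of order `N⁻¹`. -/
theorem exists_volume_lt_norm_le {r : ℝ} (hr : 0 < r) (hd : (d : ℝ) < 2 * (1 + r)) {φ : L2 d}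
    {g : Fin d → L2 d} (h : ∀ i, IsWeakPartial i φ (g i)) :
    ∃ C T : ℝ, 0 < T ∧ ∀ t, T < t →
      volume {x | t < ‖φ x‖} ≤ ENNReal.ofReal (C * t ^ (-2 - 2 / r)) := by
  obtain ⟨K, hK, hlow⟩ := exists_norm_lowpass_le hr.le hd
  set K' := K * (√(‖φ‖ ^ 2 + ∑ i, ‖g i‖ ^ 2) + 1) with hK'
  have hK'pos : 0 < K' := by positivity
  set G := ∑ i, ‖g i‖ ^ 2
  have hG : 0 ≤ G := Finset.sum_nonneg fun i _ ↦ by positivity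
  refine ⟨8 * G * (2 * K') ^ (2 / r), 2 * K' * 2 ^ (r / 2), by positivity, fun t ht ↦ ?_⟩
  have htpos : 0 < t := lt_trans (by positivity) ht
  set M := (t / (2 * K')) ^ (2 / r) with hM
  have hM2 : 2 ≤ M := by
    have : (2 : ℝ) = (2 ^ (r / 2)) ^ (2 / r) := by
      rw [← Real.rpow_mul (by norm_num)]
      field_simp
      simp
    rw [hM]
    conv_lhs => rw [this]
    gcongr
    rw [le_div_iff₀ (by positivity)]
    linarith
  have hMr : M ^ (r / 2) = t / (2 * K') := by
    rw [hM, ← Real.rpow_mul (by positivity), show 2 / r * (r / 2) = 1 by field_simp, Real.rpow_one]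
  set N := √(M - 1)
  have hN2 : N ^ 2 = M - 1 := Real.sq_sqrt (by linarith)
  -- `N` is chosen such that the low frequencies stay below `t / 2`
  have hlow' : ∀ x, ‖lowpass N φ x‖ ≤ t / 2 := by
    intro x
    refine (hlow φ g h N x (Real.sqrt_nonneg _)).trans ?_
    rw [hN2, add_sub_cancel, hMr]
    calc K * (t / (2 * K')) * √(‖φ‖ ^ 2 + G) ≤ K * (t / (2 * K')) * (√(‖φ‖ ^ 2 + G) + 1) := by
          gcongr
          linarith
      _ = K' * (t / (2 * K')) := by rw [hK']; ring
      _ = t / 2 := by field_simp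
  have hsub : volume {x | t < ‖φ x‖} ≤ volume {x | t / 2 ≤ ‖(φ - lowpassL2 N φ : L2 d) x‖} := by
    refine measure_mono_ae ?_
    filter_upwards [Lp.coeFn_sub φ (lowpassL2 N φ), lowpassL2_ae_eq N φ] with x h1 h2 hx
    change t < ‖φ x‖ at hx
    change t / 2 ≤ ‖(φ - lowpassL2 N φ : L2 d) x‖
    rw [h1, Pi.sub_apply, h2]
    have := norm_sub_norm_le (φ x) (lowpass N φ x)
    linarith [hlow' x]
  refine hsub.trans ((volume_le_norm_le _ (by positivity)).trans (ENNReal.ofReal_le_ofReal ?_))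
  have hhigh := norm_sub_lowpass_le h (Real.sqrt_nonneg (M - 1))
  change N ^ 2 * _ ≤ G at hhigh
  rw [hN2] at hhigh
  have h3 : ‖φ - lowpassL2 N φ‖ ^ 2 ≤ 2 * G / M := by
    rw [le_div_iff₀ (by linarith)]
    nlinarith [sq_nonneg ‖φ - lowpassL2 N φ‖]
  have h4 : (2 * K') ^ (2 / r) * t ^ (-2 - 2 / r) = 1 / (t ^ 2 * M) := by
    rw [hM, Real.div_rpow (by positivity) (by positivity), Real.rpow_sub htpos,
      Real.rpow_neg htpos.le, Real.rpow_two]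
    field_simp
  calc _ ≤ 2 * G / M / (t / 2) ^ 2 := by gcongr
    _ = 8 * G * (1 / (t ^ 2 * M)) := by
        have : M ≠ 0 := by linarith
        field_simp
        ring
    _ = _ := by rw [← h4]; ring

/-- Subcritical Sobolev embedding `H¹ ⊂ L^q`. -/
theorem integrable_norm_rpow_of_isWeakPartial {r q : ℝ} (hr : 0 < r) (hd : (d : ℝ) < 2 * (1 + r))
    (hq : 2 < q) (hqr : q < 2 + 2 / r) {φ : L2 d} {g : Fin d → L2 d}
    (h : ∀ i, IsWeakPartial i φ (g i)) : Integrable fun x ↦ ‖φ x‖ ^ q := by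
  obtain ⟨C, T, hT, hC⟩ := exists_volume_lt_norm_le hr hd h
  have hm : AEStronglyMeasurable (fun x ↦ ‖φ x‖) := (Lp.aestronglyMeasurable φ).norm
  refine ⟨(Real.continuous_rpow_const (by linarith)).comp_aestronglyMeasurable hm, ?_⟩
  rw [hasFiniteIntegral_iff_ofReal (.of_forall fun x ↦ by positivity),
    lintegral_rpow_eq_lintegral_meas_lt_mul volume (.of_forall fun x ↦ norm_nonneg _)
      hm.aemeasurable (by linarith)]
  refine ENNReal.mul_lt_top ENNReal.ofReal_lt_top ?_
  -- Chebyshev's inequality at small heights, the decay from the frequency splitting at large ones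
  rw [← Set.Ioc_union_Ioi_eq_Ioi hT.le, lintegral_union measurableSet_Ioi
    (Set.disjoint_left.mpr fun x hx hx' ↦ not_lt.mpr hx.2 hx')]
  refine ENNReal.add_lt_top.mpr ⟨?_, ?_⟩
  · have hi : IntegrableOn (fun t : ℝ ↦ ‖φ‖ ^ 2 * t ^ (q - 3)) (Set.Ioc 0 T) := by
      have := intervalIntegral.intervalIntegrable_rpow' (a := 0) (b := T) (r := q - 3) (by linarith)
      exact ((intervalIntegrable_iff_integrableOn_Ioc_of_le hT.le).mp this).const_mul _
    refine lt_of_le_of_lt (setLIntegral_mono_ae' measurableSet_Ioc (.of_forall fun t ht ↦ ?_))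
      hi.lintegral_lt_top
    have e : ‖φ‖ ^ 2 * t ^ (q - 3) = ‖φ‖ ^ 2 / t ^ 2 * t ^ (q - 1) := by
      have : t ^ (q - 1) = t ^ (q - 3) * t ^ 2 := by
        rw [← Real.rpow_two, ← Real.rpow_add ht.1]
        ring_nf
      rw [this]
      have := ht.1.ne'
      field_simp
    rw [e, ENNReal.ofReal_mul (by positivity)]
    gcongr
    refine (measure_mono ?_).trans (volume_le_norm_le φ ht.1)
    exact fun x (hx : t < ‖φ x‖) ↦ hx.le
  · have hi : IntegrableOn (fun t : ℝ ↦ C * t ^ (-2 - 2 / r + (q - 1))) (Set.Ioi T) :=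
      (integrableOn_Ioi_rpow_of_lt (by linarith) hT).const_mul _
    refine lt_of_le_of_lt (setLIntegral_mono_ae' measurableSet_Ioi (.of_forall fun t ht ↦ ?_))
      hi.lintegral_lt_top
    have htpos : 0 < t := hT.trans ht
    rw [Real.rpow_add htpos, ← mul_assoc, ENNReal.ofReal_mul' (by positivity)]
    gcongr
    exact hC t ht

/-- `H¹ ⊂ L^{p+1}` in the energy-subcritical range. -/
theorem integrable_norm_rpow_add_one {p : ℝ} (hp : 1 < p)
    (hpd : 3 ≤ d → p < ((d : ℝ) + 2) / ((d : ℝ) - 2)) {φ : L2 d}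
    (h : ∀ i, ∃ g, IsWeakPartial i φ g) : Integrable fun x ↦ ‖φ x‖ ^ (p + 1) := by
  choose g hg using h
  -- an exponent `r` with `(d - 2) / 2 < r < 2 / (p - 1)`
  have hex : max 0 (((d : ℝ) - 2) / 2) < 2 / (p - 1) := by
    have hp1 : 0 < p - 1 := by linarith
    refine max_lt (by positivity) ?_
    rw [lt_div_iff₀ hp1]
    rcases le_or_gt 3 d with h3 | h3
    · have h3' : (3 : ℝ) ≤ d := by exact_mod_cast h3
      have := hpd h3
      rw [lt_div_iff₀ (by linarith)] at this
      linarith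
    · have h3' : (d : ℝ) ≤ 2 := by exact_mod_cast Nat.lt_succ_iff.mp h3
      nlinarith
  obtain ⟨r, hr1, hr2⟩ := exists_between hex
  have hr0 : 0 < r := (le_max_left _ _).trans_lt hr1
  have hrd : ((d : ℝ) - 2) / 2 < r := (le_max_right _ _).trans_lt hr1
  refine integrable_norm_rpow_of_isWeakPartial hr0 (by linarith) (by linarith) ?_ hg
  rw [lt_div_iff₀ (by linarith)] at hr2
  have : p - 1 < 2 / r := by
    rw [lt_div_iff₀ hr0]
    linarith
  linarith

end

/-! ### Compactness of the form domain in `L²` -/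

section

variable {d : ℕ}

theorem exists_forall_notMem_closedBall_le {f : Space d → ℝ}
    (hf : Tendsto f (cocompact (Space d)) atTop) (A : ℝ) :
    ∃ R : ℝ, ∀ x, x ∉ Metric.closedBall (0 : Space d) R → A ≤ f x := by
  have h := hf.eventually (eventually_ge_atTop A)
  rw [← Metric.cobounded_eq_cocompact] at h
  obtain ⟨R, -, hR⟩ :=
    (Metric.hasBasis_cobounded_compl_closedBall (0 : Space d)).eventually_iff.mp h
  exact ⟨R, fun x hx ↦ hR hx⟩

/-- Bounded sequences in `L²` have weakly convergent subsequences; the limit is not named, only the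
convergence of all inner products is recorded. -/
theorem exists_subseq_tendsto_inner {u : ℕ → L2 d} {M : ℝ} (hu : ∀ n, ‖u n‖ ≤ M) :
    ∃ k : ℕ → ℕ, StrictMono k ∧
      ∀ e : L2 d, ∃ l : ℂ, Tendsto (fun n ↦ inner ℂ e (u (k n))) atTop (𝓝 l) := by
  have : Fact ((2 : ENNReal) ≠ ⊤) := ⟨by norm_num⟩
  have : SecondCountableTopology (L2 d) := inferInstance
  obtain ⟨a, -, k, hk, hlim⟩ := WeakDual.isSeqCompact_closedBall ℂ (L2 d) 0 M
    (x := fun n ↦ StrongDual.toWeakDual (InnerProductSpace.toDual ℂ (L2 d) (u n)))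
    (fun n ↦ by
      change InnerProductSpace.toDual ℂ (L2 d) (u n) ∈ Metric.closedBall 0 M
      simpa using hu n)
  refine ⟨k, hk, fun e ↦ ⟨conj (a e), ?_⟩⟩
  have h1 := (WeakDual.eval_continuous (𝕜 := ℂ) (E := L2 d) e).tendsto a |>.comp hlim
  have h2 := (Complex.continuous_conj.tendsto _).comp h1
  refine h2.congr fun n ↦ ?_
  change conj (inner ℂ (u (k n)) e) = _
  exact inner_conj_symm _ _

theorem continuous_lowpass (N : ℝ) (φ : L2 d) : Continuous (lowpass N φ) :=
  VectorFourier.fourierIntegral_continuous Real.continuous_fourierChar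
    (by exact continuous_inner.neg) (integrable_lowFreq N φ)

theorem norm_sub_sq_le (a b : ℂ) : ‖a - b‖ ^ 2 ≤ 2 * ‖a‖ ^ 2 + 2 * ‖b‖ ^ 2 := by
  have := norm_sub_le a b
  nlinarith [sq_nonneg (‖a‖ - ‖b‖), norm_nonneg (a - b), norm_nonneg a, norm_nonneg b]

/-- The low frequencies of an `H¹`-bounded, weakly convergent sequence converge locally in `L²`. -/
theorem exists_tendsto_integral_lowpass_sub {u : ℕ → L2 d} {g : ℕ → Fin d → L2 d} {M : ℝ}
    (hg : ∀ n i, IsWeakPartial i (u n) (g n i)) (hu : ∀ n, ‖u n‖ ≤ M) (hgM : ∀ n i, ‖g n i‖ ≤ M)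
    (hw : ∀ e : L2 d, ∃ l : ℂ, Tendsto (fun n ↦ inner ℂ e (u n)) atTop (𝓝 l)) (N R : ℝ)
    (hN : 0 ≤ N) : ∃ l : Space d → ℂ,
      (∀ n, IntegrableOn (fun x ↦ ‖lowpass N (u n) x - l x‖ ^ 2) (Metric.closedBall 0 R)) ∧
      Tendsto (fun n ↦ ∫ x in Metric.closedBall 0 R, ‖lowpass N (u n) x - l x‖ ^ 2) atTop
        (𝓝 0) := by
  have hpt : ∀ x, ∃ l : ℂ, Tendsto (fun n ↦ lowpass N (u n) x) atTop (𝓝 l) := fun x ↦ by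
    obtain ⟨e, he⟩ := exists_lowpass_eq_inner N x
    simpa only [he] using hw e
  choose l hl using hpt
  obtain ⟨K, hK, hKb⟩ := exists_norm_lowpass_le (d := d) (r := d) (by positivity)
    (by have : (0 : ℝ) ≤ d := by positivity
        linarith)
  have hM : 0 ≤ M := (norm_nonneg _).trans (hu 0)
  set B := K * (1 + N ^ 2) ^ ((d : ℝ) / 2) * √(M ^ 2 + ∑ _i : Fin d, M ^ 2)
  have hB : ∀ n x, ‖lowpass N (u n) x‖ ≤ B := fun n x ↦ by
    refine (hKb (u n) (g n) (hg n) N x hN).trans ?_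
    simp only [B]
    gcongr
    · exact hu n
    · exact hgM n _
  have hlB : ∀ x, ‖l x‖ ≤ B := fun x ↦
    le_of_tendsto (hl x).norm (.of_forall fun n ↦ hB n x)
  have hBsq : ∀ n x, ‖‖lowpass N (u n) x - l x‖ ^ 2‖ ≤ 4 * B ^ 2 := fun n x ↦ by
    rw [Real.norm_of_nonneg (by positivity)]
    have h1 := norm_sub_sq_le (lowpass N (u n) x) (l x)
    have h2 : ‖lowpass N (u n) x‖ ^ 2 ≤ B ^ 2 := by gcongr; exact hB n x
    have h3 : ‖l x‖ ^ 2 ≤ B ^ 2 := by gcongr; exact hlB x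
    linarith
  have hlm : StronglyMeasurable l :=
    stronglyMeasurable_of_tendsto atTop (fun n ↦ (continuous_lowpass N (u n)).stronglyMeasurable)
      (tendsto_pi_nhds.mpr hl)
  have hm : ∀ n, AEStronglyMeasurable (fun x ↦ ‖lowpass N (u n) x - l x‖ ^ 2)
      (volume.restrict (Metric.closedBall 0 R)) := fun n ↦
    (((continuous_lowpass N (u n)).stronglyMeasurable.sub hlm).norm.pow 2).aestronglyMeasurable
  have : IsFiniteMeasure (volume.restrict (Metric.closedBall (0 : Space d) R)) :=
    ⟨by simpa using measure_closedBall_lt_top⟩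
  refine ⟨l, fun n ↦ Integrable.of_bound (hm n) _ (.of_forall (hBsq n)), ?_⟩
  have := tendsto_integral_of_dominated_convergence (μ := volume.restrict (Metric.closedBall 0 R))
    (F := fun n x ↦ ‖lowpass N (u n) x - l x‖ ^ 2) (f := fun _ ↦ 0) (fun _ ↦ 4 * B ^ 2) hm
    (integrable_const _) (fun n ↦ .of_forall (hBsq n)) (.of_forall fun x ↦ ?_)
  · simpa using this
  · simpa using (((hl x).sub_const (l x)).norm.pow 2)

/-- Compactness of the embedding of the form domain into `L²`: outside a large ball the mass is
controlled by the potential, inside it high frequencies are controlled by the gradient, and low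
frequencies converge by weak compactness. -/
theorem exists_subseq_tendsto {V : Space d → ℝ} (hV : ∀ x, 0 ≤ V x)
    (hVc : Tendsto V (cocompact (Space d)) atTop) {u : ℕ → L2 d} {g : ℕ → Fin d → L2 d} {M : ℝ}
    (hg : ∀ n i, IsWeakPartial i (u n) (g n i)) (hu : ∀ n, ‖u n‖ ≤ M) (hgM : ∀ n i, ‖g n i‖ ≤ M)
    (hVi : ∀ n, Integrable fun x ↦ V x * ‖u n x‖ ^ 2) (hVM : ∀ n, ∫ x, V x * ‖u n x‖ ^ 2 ≤ M) :
    ∃ (φ : L2 d) (k : ℕ → ℕ), StrictMono k ∧ Tendsto (fun n ↦ u (k n)) atTop (𝓝 φ) := by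
  obtain ⟨k, hk, hw⟩ := exists_subseq_tendsto_inner hu
  have hM : 0 ≤ M := (norm_nonneg _).trans (hu 0)
  suffices hc : CauchySeq fun n ↦ u (k n) by
    obtain ⟨φ, hφ⟩ := cauchySeq_tendsto_of_complete hc
    exact ⟨φ, k, hk, hφ⟩
  rw [Metric.cauchySeq_iff]
  intro ε hε
  set η := ε ^ 2 / 4 with hη
  have hηpos : 0 < η := by positivity
  -- cut off at `|ξ| ≤ N` in frequency and at `|x| ≤ R` in space
  obtain ⟨N, hN1, hN⟩ : ∃ N : ℝ, 1 ≤ N ∧ 6 * (d * M ^ 2) / N ^ 2 ≤ η := by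
    refine ⟨max 1 (6 * (d * M ^ 2) / η), le_max_left _ _, ?_⟩
    have h1 := le_max_left 1 (6 * (d * M ^ 2) / η)
    have h2 := le_max_right 1 (6 * (d * M ^ 2) / η)
    rw [div_le_iff₀ hηpos] at h2
    rw [div_le_iff₀ (by positivity)]
    have h3 := mul_le_mul_of_nonneg_left (le_self_pow₀ h1 two_ne_zero) hηpos.le
    linarith
  obtain ⟨A, hA0, hA⟩ : ∃ A : ℝ, 0 < A ∧ 4 * M / A ≤ η := by
    refine ⟨4 * M / η + 1, by positivity, ?_⟩
    rw [div_le_iff₀ (by positivity), mul_add, mul_div_cancel₀ _ hηpos.ne']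
    linarith
  obtain ⟨R, hR⟩ := exists_forall_notMem_closedBall_le hVc A
  obtain ⟨l, hli, hl⟩ := exists_tendsto_integral_lowpass_sub (fun n ↦ hg (k n))
    (fun n ↦ hu (k n)) (fun n ↦ hgM (k n)) hw N R (by linarith)
  obtain ⟨n₀, hn₀⟩ :=
    (hl.eventually (gt_mem_nhds (by positivity : 0 < η / 12))).exists_forall_of_atTop
  refine ⟨n₀, fun m hm n hn ↦ ?_⟩
  set v := fun n ↦ u (k n)
  have hhigh : ∀ n, ‖v n - lowpassL2 N (v n)‖ ^ 2 ≤ d * M ^ 2 / N ^ 2 := fun n ↦ by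
    rw [le_div_iff₀' (by positivity)]
    refine (norm_sub_lowpass_le (hg (k n)) (by linarith)).trans ?_
    calc _ ≤ ∑ _i : Fin d, M ^ 2 := by
          gcongr
          exact hgM _ _
      _ = _ := by simp
  set F := fun (n : ℕ) (x : Space d) ↦ (Metric.closedBall 0 R).indicator
    (fun x ↦ ‖lowpass N (v n) x - l x‖ ^ 2) x
  have hF : ∀ n, Integrable (F n) := fun n ↦
    (integrable_indicator_iff measurableSet_closedBall).mpr (hli n)
  have hFi : ∀ n, n₀ ≤ n → ∫ x, F n x < η / 12 := fun n hn ↦ by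
    rw [integral_indicator measurableSet_closedBall]
    exact hn₀ n hn
  have hpt : ∀ᵐ x, ‖(v m - v n : L2 d) x‖ ^ 2 ≤ 6 * F m x + 6 * F n x
      + 3 * ‖(v m - lowpassL2 N (v m) : L2 d) x‖ ^ 2
      + 3 * ‖(v n - lowpassL2 N (v n) : L2 d) x‖ ^ 2
      + 2 / A * (V x * ‖v m x‖ ^ 2) + 2 / A * (V x * ‖v n x‖ ^ 2) := by
    filter_upwards [Lp.coeFn_sub (v m) (v n), Lp.coeFn_sub (v m) (lowpassL2 N (v m)),
      Lp.coeFn_sub (v n) (lowpassL2 N (v n)), lowpassL2_ae_eq N (v m), lowpassL2_ae_eq N (v n)]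
      with x e1 e2 e3 e4 e5
    rw [e1, e2, e3]
    simp only [Pi.sub_apply, e4, e5]
    have hV1 : 0 ≤ V x * ‖v m x‖ ^ 2 := mul_nonneg (hV x) (by positivity)
    have hV2 : 0 ≤ V x * ‖v n x‖ ^ 2 := mul_nonneg (hV x) (by positivity)
    by_cases hx : x ∈ Metric.closedBall (0 : Space d) R
    · simp only [F, Set.indicator_of_mem hx]
      have h1 := norm_sub_sq_le (lowpass N (v m) x - l x) (lowpass N (v n) x - l x)
      rw [sub_sub_sub_cancel_right] at h1
      have h2 : ‖v m x - v n x‖ ≤ ‖lowpass N (v m) x - lowpass N (v n) x‖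
          + ‖v m x - lowpass N (v m) x‖ + ‖v n x - lowpass N (v n) x‖ := by
        have := norm_sub_le (lowpass N (v m) x - lowpass N (v n) x + (v m x - lowpass N (v m) x))
          (v n x - lowpass N (v n) x)
        have h3 := norm_add_le (lowpass N (v m) x - lowpass N (v n) x) (v m x - lowpass N (v m) x)
        rw [show lowpass N (v m) x - lowpass N (v n) x + (v m x - lowpass N (v m) x)
          - (v n x - lowpass N (v n) x) = v m x - v n x by ring] at this
        linarith
      have h4 : ‖v m x - v n x‖ ^ 2 ≤ 3 * ‖lowpass N (v m) x - lowpass N (v n) x‖ ^ 2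
          + 3 * ‖v m x - lowpass N (v m) x‖ ^ 2 + 3 * ‖v n x - lowpass N (v n) x‖ ^ 2 := by
        refine (pow_le_pow_left₀ (norm_nonneg _) h2 2).trans ?_
        generalize ‖lowpass N (v m) x - lowpass N (v n) x‖ = a
        generalize ‖v m x - lowpass N (v m) x‖ = b
        generalize ‖v n x - lowpass N (v n) x‖ = c
        nlinarith [sq_nonneg (a - b), sq_nonneg (a - c), sq_nonneg (b - c)]
      have h5 : 0 ≤ 2 / A * (V x * ‖v m x‖ ^ 2) := by positivity
      have h6 : 0 ≤ 2 / A * (V x * ‖v n x‖ ^ 2) := by positivity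
      linarith
    · simp only [F, Set.indicator_of_notMem hx]
      have hAx := hR x hx
      have h1 := norm_sub_sq_le (v m x) (v n x)
      have h2 : ∀ z : ℂ, 2 * ‖z‖ ^ 2 ≤ 2 / A * (V x * ‖z‖ ^ 2) := fun z ↦ by
        rw [div_mul_eq_mul_div, le_div_iff₀ hA0]
        nlinarith [sq_nonneg ‖z‖]
      have h3 := h2 (v m x)
      have h4 := h2 (v n x)
      have h5 : 0 ≤ ‖v m x - lowpass N (v m) x‖ ^ 2 := by positivity
      have h6 : 0 ≤ ‖v n x - lowpass N (v n) x‖ ^ 2 := by positivity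
      linarith
  have i1 := (hF m).const_mul 6
  have i2 := (hF n).const_mul 6
  have i3 := (integrable_norm_sq (v m - lowpassL2 N (v m))).const_mul 3
  have i4 := (integrable_norm_sq (v n - lowpassL2 N (v n))).const_mul 3
  have i5 := (hVi (k m)).const_mul (2 / A)
  have i6 := (hVi (k n)).const_mul (2 / A)
  have hint := integral_mono_ae (integrable_norm_sq (v m - v n))
    (((((i1.add i2).add i3).add i4).add i5).add i6) hpt
  rw [integral_norm_sq_eq, integral_add' ((((i1.add i2).add i3).add i4).add i5) i6,
    integral_add' (((i1.add i2).add i3).add i4) i5, integral_add' ((i1.add i2).add i3) i4,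
    integral_add' (i1.add i2) i3, integral_add' i1 i2] at hint
  simp only [integral_const_mul, integral_norm_sq_eq] at hint
  have b1 := hFi m hm
  have b2 := hFi n hn
  have b3 := hhigh m
  have b4 := hhigh n
  have b5 : 2 / A * ∫ x, V x * ‖v m x‖ ^ 2 ≤ 2 / A * M :=
    mul_le_mul_of_nonneg_left (hVM (k m)) (by positivity)
  have b6 : 2 / A * ∫ x, V x * ‖v n x‖ ^ 2 ≤ 2 / A * M :=
    mul_le_mul_of_nonneg_left (hVM (k n)) (by positivity)
  have e1 : 6 * (d * M ^ 2) / N ^ 2 = 6 * (d * M ^ 2 / N ^ 2) := by ring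
  have e2 : 4 * M / A = 2 * (2 / A * M) := by ring
  rw [dist_eq_norm]
  refine lt_of_pow_lt_pow_left₀ 2 hε.le ?_
  change ‖v m - v n‖ ^ 2 < ε ^ 2
  linarith

end

/-! ### The form domain and the rotation term -/

section

variable {d : ℕ} {V : Space d → ℝ} {φ ψ v : L2 d}

theorem X.isWeakPartial (h : φ ∈ X V) (i : Fin d) : IsWeakPartial i φ (weakPartial i φ) :=
  isWeakPartial_weakPartial (h.1 i)

theorem X.add_mem (hV : Measurable V) (hV0 : ∀ x, 0 ≤ V x) (hφ : φ ∈ X V) (hψ : ψ ∈ X V) :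
    φ + ψ ∈ X V := by
  refine ⟨fun i ↦ ⟨_, (X.isWeakPartial hφ i).add (X.isWeakPartial hψ i)⟩, ?_⟩
  refine ((hφ.2.const_mul 2).add (hψ.2.const_mul 2)).mono'
    (hV.aestronglyMeasurable.mul ((Lp.aestronglyMeasurable _).norm.pow 2)) ?_
  filter_upwards [Lp.coeFn_add φ ψ] with x hx
  rw [hx, Real.norm_of_nonneg (mul_nonneg (hV0 x) (by positivity))]
  have := norm_sub_sq_le (φ x) (-ψ x)
  rw [sub_neg_eq_add, norm_neg] at this
  calc _ ≤ V x * (2 * ‖φ x‖ ^ 2 + 2 * ‖ψ x‖ ^ 2) := mul_le_mul_of_nonneg_left this (hV0 x)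
    _ = _ := by simp only [Pi.add_apply]; ring

theorem X.smul_mem (c : ℂ) (hφ : φ ∈ X V) : c • φ ∈ X V := by
  refine ⟨fun i ↦ ⟨_, (X.isWeakPartial hφ i).smul c⟩, ?_⟩
  refine (hφ.2.const_mul (‖c‖ ^ 2)).congr ?_
  filter_upwards [Lp.coeFn_smul c φ] with x hx
  rw [hx, Pi.smul_apply, norm_smul]
  ring

theorem X.sub_mem (hV : Measurable V) (hV0 : ∀ x, 0 ≤ V x) (hφ : φ ∈ X V) (hψ : ψ ∈ X V) :
    φ - ψ ∈ X V := by
  have := X.add_mem hV hV0 hφ (X.smul_mem (-1) hψ)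
  rwa [neg_one_smul, ← sub_eq_add_neg] at this

theorem weakPartial_add (hφ : φ ∈ X V) (hψ : ψ ∈ X V) (i : Fin d) :
    weakPartial i (φ + ψ) = weakPartial i φ + weakPartial i ψ :=
  weakPartial_eq ((X.isWeakPartial hφ i).add (X.isWeakPartial hψ i))

theorem weakPartial_smul (c : ℂ) (hφ : φ ∈ X V) (i : Fin d) :
    weakPartial i (c • φ) = c • weakPartial i φ :=
  weakPartial_eq ((X.isWeakPartial hφ i).smul c)

theorem weakPartial_sub (hφ : φ ∈ X V) (hψ : ψ ∈ X V) (i : Fin d) :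
    weakPartial i (φ - ψ) = weakPartial i φ - weakPartial i ψ := by
  have := weakPartial_add hφ (X.smul_mem (-1) hψ) i
  rw [weakPartial_smul (-1) hψ, neg_one_smul, neg_one_smul, ← sub_eq_add_neg,
    ← sub_eq_add_neg] at this
  exact this

/-- Either there is no rotation, or the centrifugal weight `γ² (x₁² + x₂²) / 2` of some speed
`γ > |Ω|` is dominated by the potential up to a constant. -/
def RotationBound (V : Space d → ℝ) (Ω : ℝ) : Prop :=
  Ω = 0 ∨ ∃ γ C : ℝ, |Ω| < γ ∧ 0 ≤ C ∧ ∀ x, γ ^ 2 / 2 * axisDistSq x ≤ V x + C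

theorem continuous_axisDistSq : Continuous (axisDistSq : Space d → ℝ) := by
  unfold axisDistSq
  split_ifs <;> fun_prop

theorem rotationBound_of_lt_OmegaMax (hV0 : ∀ x, 0 ≤ V x) {Ω : ℝ}
    (hΩ : Ω = 0 ∨ (0 < |Ω| ∧ ((|Ω| : ℝ) : EReal) < OmegaMax V)) : RotationBound V Ω := by
  rcases hΩ with h | ⟨-, h⟩
  · exact Or.inl h
  right
  obtain ⟨_, ⟨γ, ⟨-, hγ⟩, rfl⟩, hlt⟩ := lt_sSup_iff.mp h
  have hlt' : |Ω| < γ := EReal.coe_lt_coe_iff.mp hlt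
  obtain ⟨R, hR⟩ := exists_forall_notMem_closedBall_le hγ 0
  obtain ⟨A, hA⟩ := (isCompact_closedBall (0 : Space d) R).exists_bound_of_continuousOn
    continuous_axisDistSq.continuousOn
  refine ⟨γ, γ ^ 2 / 2 * |A|, hlt', by positivity, fun x ↦ ?_⟩
  by_cases hx : x ∈ Metric.closedBall (0 : Space d) R
  · have h1 := (le_abs_self _).trans ((hA x hx).trans (le_abs_self A))
    have h2 := mul_le_mul_of_nonneg_left h1 (by positivity : 0 ≤ γ ^ 2 / 2)
    linarith [hV0 x]
  · have h1 := hR x hx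
    have h2 : 0 ≤ γ ^ 2 / 2 * |A| := by positivity
    linarith

theorem Lz_eq (h : 2 ≤ d) (φ : L2 d) (x : Space d) : Lz φ x =
    Complex.I * ((x ⟨1, h⟩ : ℂ) * weakPartial ⟨0, by omega⟩ φ x
      - (x ⟨0, by omega⟩ : ℂ) * weakPartial ⟨1, h⟩ φ x) := by
  rw [Lz, dif_pos h]

theorem Lz_eq_zero (h : ¬2 ≤ d) (φ : L2 d) (x : Space d) : Lz φ x = 0 := by
  rw [Lz, dif_neg h]

theorem axisDistSq_eq (h : 2 ≤ d) (x : Space d) :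
    axisDistSq x = x ⟨0, by omega⟩ ^ 2 + x ⟨1, h⟩ ^ 2 := by
  rw [axisDistSq, dif_pos h]

theorem memLp_coord_mul_of_sq_le {γ C : ℝ} (hγ : 0 < γ) (hφ : φ ∈ X V) {k : Fin d}
    (h : ∀ x : Space d, γ ^ 2 / 2 * x k ^ 2 ≤ V x + C) : MemLp (fun x ↦ (x k : ℂ) * φ x) 2 := by
  have hm : AEStronglyMeasurable (fun x : Space d ↦ (x k : ℂ) * φ x) :=
    (by fun_prop : Continuous fun x : Space d ↦ (x k : ℂ)).aestronglyMeasurable.mul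
      (Lp.aestronglyMeasurable _)
  rw [memLp_two_iff_integrable_sq_norm hm]
  refine ((hφ.2.add ((integrable_norm_sq φ).const_mul C)).const_mul (2 / γ ^ 2)).mono'
    (hm.norm.pow 2) (.of_forall fun x ↦ ?_)
  rw [Real.norm_of_nonneg (by positivity), norm_mul, mul_pow, Complex.norm_real, Real.norm_eq_abs,
    sq_abs]
  have := mul_le_mul_of_nonneg_right (h x) (sq_nonneg ‖φ x‖)
  simp only [Pi.add_apply]
  rw [div_mul_eq_mul_div, le_div_iff₀ (by positivity)]
  linarith

theorem memLp_coord_mul (hd : 2 ≤ d) {γ C : ℝ} (hγ : 0 < γ) (hφ : φ ∈ X V)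
    (h : ∀ x, γ ^ 2 / 2 * axisDistSq x ≤ V x + C) :
    MemLp (fun x ↦ (x ⟨0, by omega⟩ : ℂ) * φ x) 2 ∧ MemLp (fun x ↦ (x ⟨1, hd⟩ : ℂ) * φ x) 2 := by
  have hγ2 : 0 ≤ γ ^ 2 / 2 := by positivity
  constructor
  · refine memLp_coord_mul_of_sq_le (C := C) hγ hφ fun x ↦
      (mul_le_mul_of_nonneg_left ?_ hγ2).trans (h x)
    rw [axisDistSq_eq hd]
    nlinarith [sq_nonneg (x ⟨1, hd⟩)]
  · refine memLp_coord_mul_of_sq_le (C := C) hγ hφ fun x ↦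
      (mul_le_mul_of_nonneg_left ?_ hγ2).trans (h x)
    rw [axisDistSq_eq hd]
    nlinarith [sq_nonneg (x ⟨0, by omega⟩)]

theorem integrable_mul_conj_of_memLp {f g : Space d → ℂ} (hf : MemLp f 2) (hg : MemLp g 2) :
    Integrable fun x ↦ f x * conj (g x) :=
  hf.integrable_mul hg.star

theorem Lz_add_ae (hφ : φ ∈ X V) (hψ : ψ ∈ X V) :
    ∀ᵐ x, Lz (φ + ψ) x = Lz φ x + Lz ψ x := by
  by_cases hd : 2 ≤ d
  · filter_upwards [Lp.coeFn_add (weakPartial ⟨0, by omega⟩ φ) (weakPartial ⟨0, by omega⟩ ψ),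
      Lp.coeFn_add (weakPartial ⟨1, hd⟩ φ) (weakPartial ⟨1, hd⟩ ψ)] with x h0 h1
    rw [Lz_eq hd, Lz_eq hd, Lz_eq hd, weakPartial_add hφ hψ, weakPartial_add hφ hψ, h0, h1]
    simp only [Pi.add_apply]
    ring
  · simp [Lz_eq_zero hd]

theorem Lz_smul_ae (c : ℂ) (hφ : φ ∈ X V) : ∀ᵐ x, Lz (c • φ) x = c * Lz φ x := by
  by_cases hd : 2 ≤ d
  · filter_upwards [Lp.coeFn_smul c (weakPartial ⟨0, by omega⟩ φ),
      Lp.coeFn_smul c (weakPartial ⟨1, hd⟩ φ)] with x h0 h1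
    rw [Lz_eq hd, Lz_eq hd, weakPartial_smul c hφ, weakPartial_smul c hφ, h0, h1]
    simp only [Pi.smul_apply, smul_eq_mul]
    ring
  · simp [Lz_eq_zero hd]

theorem Lz_mul_conj_eq (hd : 2 ≤ d) (φ v : L2 d) (x : Space d) : Lz φ x * conj (v x) =
    Complex.I * (weakPartial ⟨0, by omega⟩ φ x * conj ((x ⟨1, hd⟩ : ℂ) * v x)
      - weakPartial ⟨1, hd⟩ φ x * conj ((x ⟨0, by omega⟩ : ℂ) * v x)) := by
  rw [Lz_eq hd, map_mul, map_mul, Complex.conj_ofReal, Complex.conj_ofReal]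
  ring

theorem integrable_Lz_mul_conj {γ C : ℝ} (hγ : 0 < γ)
    (h : ∀ x, γ ^ 2 / 2 * axisDistSq x ≤ V x + C) (φ : L2 d) (hv : v ∈ X V) :
    Integrable fun x ↦ Lz φ x * conj (v x) := by
  by_cases hd : 2 ≤ d
  · obtain ⟨h0, h1⟩ := memLp_coord_mul hd hγ hv h
    simp only [Lz_mul_conj_eq hd]
    exact ((integrable_mul_conj_of_memLp (Lp.memLp _) h1).sub
      (integrable_mul_conj_of_memLp (Lp.memLp _) h0)).const_mul _
  · simp [Lz_eq_zero hd]

/-- The angular momentum operator is symmetric on the form domain. -/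
theorem integral_Lz_mul_conj_symm {γ C : ℝ} (hγ : 0 < γ)
    (h : ∀ x, γ ^ 2 / 2 * axisDistSq x ≤ V x + C) (hφ : φ ∈ X V) (hv : v ∈ X V) :
    ∫ x, Lz φ x * conj (v x) = conj (∫ x, Lz v x * conj (φ x)) := by
  by_cases hd : 2 ≤ d
  · obtain ⟨v0, v1⟩ := memLp_coord_mul hd hγ hv h
    obtain ⟨w0, w1⟩ := memLp_coord_mul hd hγ hφ h
    have ne : (⟨0, by omega⟩ : Fin d) ≠ ⟨1, hd⟩ := by simp
    have e1 := (X.isWeakPartial hv ⟨0, by omega⟩).integral_coord_mul ne.symm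
      (X.isWeakPartial hφ ⟨0, by omega⟩) v1 w1
    have e0 := (X.isWeakPartial hv ⟨1, hd⟩).integral_coord_mul ne
      (X.isWeakPartial hφ ⟨1, hd⟩) v0 w0
    have c : ∀ a b : Space d → ℂ, conj (∫ x, a x * conj (b x)) = ∫ x, conj (a x) * b x :=
      fun a b ↦ by
        rw [← integral_conj]
        simp
    simp only [Lz_mul_conj_eq hd]
    rw [integral_const_mul, integral_const_mul,
      integral_sub (integrable_mul_conj_of_memLp (Lp.memLp _) v1)
        (integrable_mul_conj_of_memLp (Lp.memLp _) v0),
      integral_sub (integrable_mul_conj_of_memLp (Lp.memLp _) w1)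
        (integrable_mul_conj_of_memLp (Lp.memLp _) w0), map_mul, map_sub, c, c, e1, e0,
      Complex.conj_I]
    simp only [mul_comm (conj _)]
    ring
  · simp [Lz_eq_zero hd]

/-- The energy of the problem without rotation and interaction, `∫ (|∇φ|² / 2 + V |φ|²)`. -/
noncomputable def trapEnergy (V : Space d → ℝ) (φ : L2 d) : ℝ :=
  1 / 2 * ∑ i, ‖weakPartial i φ‖ ^ 2 + ∫ x, V x * ‖φ x‖ ^ 2

theorem trapEnergy_nonneg (hV0 : ∀ x, 0 ≤ V x) (φ : L2 d) : 0 ≤ trapEnergy V φ :=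
  add_nonneg (by positivity) (integral_nonneg fun x ↦ mul_nonneg (hV0 x) (by positivity))

theorem norm_weakPartial_sq_le (hV0 : ∀ x, 0 ≤ V x) (φ : L2 d) (i : Fin d) :
    ‖weakPartial i φ‖ ^ 2 ≤ 2 * trapEnergy V φ := by
  have h1 := Finset.single_le_sum (f := fun i ↦ ‖weakPartial i φ‖ ^ 2)
    (fun i _ ↦ by positivity) (Finset.mem_univ i)
  have h2 : 0 ≤ ∫ x, V x * ‖φ x‖ ^ 2 := integral_nonneg fun x ↦ mul_nonneg (hV0 x) (by positivity)
  unfold trapEnergy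
  linarith

theorem integral_potential_le (φ : L2 d) : ∫ x, V x * ‖φ x‖ ^ 2 ≤ trapEnergy V φ := by
  have h : 0 ≤ ∑ i, ‖weakPartial i φ‖ ^ 2 := by positivity
  unfold trapEnergy
  linarith

/-- Below the critical speed, the rotation is a relatively bounded perturbation with relative bound
`θ = |Ω| / γ < 1`. -/
theorem exists_abs_rotationEnergy_le (hV0 : ∀ x, 0 ≤ V x) {Ω : ℝ} (hR : RotationBound V Ω) :
    ∃ θ C : ℝ, 0 ≤ θ ∧ θ < 1 ∧ 0 ≤ C ∧ ∀ φ ∈ X V,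
      |rotationEnergy Ω φ| ≤ θ * (trapEnergy V φ + C * ‖φ‖ ^ 2) := by
  rcases hR with rfl | ⟨γ, C, hγ, hC, h⟩
  · exact ⟨0, 0, le_rfl, one_pos, le_rfl, fun φ _ ↦ by simp [rotationEnergy]⟩
  have hγ0 : 0 < γ := (abs_nonneg _).trans_lt hγ
  refine ⟨|Ω| / γ, C, by positivity, (div_lt_one hγ0).mpr hγ, hC, fun φ hφ ↦ ?_⟩
  have hkey : γ * ‖∫ x, conj (φ x) * Lz φ x‖ ≤ trapEnergy V φ + C * ‖φ‖ ^ 2 := by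
    have i1 : Integrable fun x ↦ 1 / 2 * ∑ i, ‖weakPartial i φ x‖ ^ 2 :=
      (integrable_finsetSum _ fun i _ ↦ integrable_norm_sq (weakPartial i φ)).const_mul _
    have e : trapEnergy V φ + C * ‖φ‖ ^ 2 = ∫ x, (1 / 2 * ∑ i, ‖weakPartial i φ x‖ ^ 2
        + V x * ‖φ x‖ ^ 2 + C * ‖φ x‖ ^ 2) := by
      have e1 := integral_add (i1.add hφ.2) ((integrable_norm_sq φ).const_mul C)
      simp only [Pi.add_apply] at e1
      rw [e1, integral_add i1 hφ.2, integral_const_mul, integral_const_mul,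
        integral_finsetSum _ fun i _ ↦ integrable_norm_sq (weakPartial i φ)]
      simp only [integral_norm_sq_eq]
      rfl
    rw [e]
    have hi := (integrable_Lz_mul_conj hγ0 h φ hφ).norm.const_mul γ
    calc _ ≤ γ * ∫ x, ‖conj (φ x) * Lz φ x‖ := by gcongr; exact norm_integral_le_integral_norm _
      _ = ∫ x, γ * ‖Lz φ x * conj (φ x)‖ := by
          rw [integral_const_mul]
          simp only [mul_comm (conj _)]
      _ ≤ _ := by
          refine integral_mono hi
            ((i1.add hφ.2).add ((integrable_norm_sq φ).const_mul C)) fun x ↦ ?_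
          rw [norm_mul, RCLike.norm_conj]
          have hs : 0 ≤ ∑ i, ‖weakPartial i φ x‖ ^ 2 := by positivity
          have hVC : 0 ≤ V x * ‖φ x‖ ^ 2 := mul_nonneg (hV0 x) (by positivity)
          by_cases hd : 2 ≤ d
          · have h1 : ‖weakPartial ⟨0, by omega⟩ φ x‖ ^ 2 + ‖weakPartial ⟨1, hd⟩ φ x‖ ^ 2
                ≤ ∑ i, ‖weakPartial i φ x‖ ^ 2 := by
              have ne : (⟨0, by omega⟩ : Fin d) ≠ ⟨1, hd⟩ := by simp
              rw [← Finset.sum_pair (f := fun i ↦ ‖weakPartial i φ x‖ ^ 2) ne]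
              exact Finset.sum_le_sum_of_subset_of_nonneg (Finset.subset_univ _)
                fun i _ _ ↦ by positivity
            have h2 : ‖Lz φ x‖ ≤ |x ⟨1, hd⟩| * ‖weakPartial ⟨0, by omega⟩ φ x‖
                + |x ⟨0, by omega⟩| * ‖weakPartial ⟨1, hd⟩ φ x‖ := by
              rw [Lz_eq hd, norm_mul, Complex.norm_I, one_mul]
              refine (norm_sub_le _ _).trans (le_of_eq ?_)
              simp
            have h3 := mul_le_mul_of_nonneg_right (h x) (sq_nonneg ‖φ x‖)
            rw [axisDistSq_eq hd] at h3
            have h4 := mul_le_mul_of_nonneg_right h2 (norm_nonneg (φ x))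
            have h5 := mul_le_mul_of_nonneg_left h4 hγ0.le
            refine h5.trans ?_
            have s0 := sq_abs (x ⟨0, by omega⟩)
            have s1 := sq_abs (x ⟨1, hd⟩)
            rw [← s0, ← s1] at h3
            generalize |x ⟨1, hd⟩| = y at *
            generalize |x ⟨0, by omega⟩| = z at *
            generalize ‖weakPartial ⟨0, by omega⟩ φ x‖ = a at *
            generalize ‖weakPartial ⟨1, hd⟩ φ x‖ = b at *
            generalize ‖φ x‖ = f at *
            -- `γ y f a ≤ (a² + γ² y² f²) / 2`, and likewise for `b`
            nlinarith [sq_nonneg (a - γ * y * f), sq_nonneg (b - γ * z * f)]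
          · rw [Lz_eq_zero hd, norm_zero, zero_mul, mul_zero]
            positivity
  rw [rotationEnergy, abs_mul, abs_neg, div_mul_eq_mul_div, le_div_iff₀ hγ0]
  have h1 := Complex.abs_re_le_norm (∫ x, conj (φ x) * Lz φ x)
  calc |Ω| * |(∫ x, conj (φ x) * Lz φ x).re| * γ ≤ |Ω| * ‖∫ x, conj (φ x) * Lz φ x‖ * γ := by
        gcongr
    _ = |Ω| * (γ * ‖∫ x, conj (φ x) * Lz φ x‖) := by ring
    _ ≤ _ := by gcongr

end

/-! ### The sesquilinear energy form -/

section

variable {d : ℕ} {V : Space d → ℝ} {Ω : ℝ} {φ ψ v : L2 d}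

/-- The sesquilinear form of `-Δ/2 + V - Ω L_z` on the form domain, linear in the first argument. -/
noncomputable def energyForm (V : Space d → ℝ) (Ω : ℝ) (φ v : L2 d) : ℂ :=
  1 / 2 * ∑ i, (∫ x, weakPartial i φ x * conj (weakPartial i v x))
    + (∫ x, (V x : ℂ) * φ x * conj (v x)) - (Ω : ℂ) * (∫ x, Lz φ x * conj (v x))

theorem integral_mul_conj_eq_inner (f g : L2 d) : ∫ x, f x * conj (g x) = inner ℂ g f := by
  rw [L2.inner_def]
  rfl

theorem integral_mul_conj_symm (f g : L2 d) :
    ∫ x, f x * conj (g x) = conj (∫ x, g x * conj (f x)) := by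
  rw [integral_mul_conj_eq_inner, integral_mul_conj_eq_inner, inner_conj_symm]

theorem integrable_potential_mul_conj (hV : Measurable V) (hV0 : ∀ x, 0 ≤ V x) (hφ : φ ∈ X V)
    (hv : v ∈ X V) : Integrable fun x ↦ (V x : ℂ) * φ x * conj (v x) := by
  refine (hφ.2.add hv.2).mono' ?_ (.of_forall fun x ↦ ?_)
  · exact ((Complex.measurable_ofReal.comp hV).aestronglyMeasurable.mul
      (Lp.aestronglyMeasurable φ)).mul (Lp.aestronglyMeasurable v).star
  · rw [norm_mul, norm_mul, RCLike.norm_conj, Complex.norm_real, Real.norm_of_nonneg (hV0 x),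
      mul_assoc]
    calc _ ≤ V x * (‖φ x‖ ^ 2 + ‖v x‖ ^ 2) := by
          gcongr
          · exact hV0 x
          · nlinarith [sq_nonneg (‖φ x‖ - ‖v x‖), sq_nonneg ‖φ x‖, sq_nonneg ‖v x‖]
      _ = _ := by simp only [Pi.add_apply]; ring

theorem integral_Lz_add (hR : RotationBound V Ω) (hφ : φ ∈ X V) (hψ : ψ ∈ X V) (hv : v ∈ X V) :
    (Ω : ℂ) * ∫ x, Lz (φ + ψ) x * conj (v x) =
      Ω * (∫ x, Lz φ x * conj (v x)) + Ω * ∫ x, Lz ψ x * conj (v x) := by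
  rcases hR with rfl | ⟨γ, C, hγ, -, h⟩
  · simp
  have hγ0 : 0 < γ := (abs_nonneg _).trans_lt hγ
  rw [← mul_add, ← integral_add (integrable_Lz_mul_conj hγ0 h φ hv)
    (integrable_Lz_mul_conj hγ0 h ψ hv)]
  congr 1
  refine integral_congr_ae ?_
  filter_upwards [Lz_add_ae hφ hψ] with x hx
  rw [hx, add_mul]

theorem energyForm_add_left (hV : Measurable V) (hV0 : ∀ x, 0 ≤ V x) (hR : RotationBound V Ω)
    (hφ : φ ∈ X V) (hψ : ψ ∈ X V) (hv : v ∈ X V) :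
    energyForm V Ω (φ + ψ) v = energyForm V Ω φ v + energyForm V Ω ψ v := by
  have e1 : ∫ x, (V x : ℂ) * (φ + ψ : L2 d) x * conj (v x) =
      (∫ x, (V x : ℂ) * φ x * conj (v x)) + ∫ x, (V x : ℂ) * ψ x * conj (v x) := by
    rw [← integral_add (integrable_potential_mul_conj hV hV0 hφ hv)
      (integrable_potential_mul_conj hV hV0 hψ hv)]
    refine integral_congr_ae ?_
    filter_upwards [Lp.coeFn_add φ ψ] with x hx
    rw [hx]
    simp only [Pi.add_apply]
    ring
  unfold energyForm
  rw [integral_Lz_add hR hφ hψ hv, e1]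
  simp only [integral_mul_conj_eq_inner, weakPartial_add hφ hψ, inner_add_right,
    Finset.sum_add_distrib]
  ring

theorem energyForm_smul_left (c : ℂ) (hφ : φ ∈ X V) (v : L2 d) :
    energyForm V Ω (c • φ) v = c * energyForm V Ω φ v := by
  have e1 : ∫ x, (V x : ℂ) * (c • φ : L2 d) x * conj (v x) =
      c * (∫ x, (V x : ℂ) * φ x * conj (v x)) := by
    rw [← integral_const_mul]
    refine integral_congr_ae ?_
    filter_upwards [Lp.coeFn_smul c φ] with x hx
    rw [hx]
    simp only [Pi.smul_apply, smul_eq_mul]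
    ring
  have e2 : ∫ x, Lz (c • φ) x * conj (v x) = c * (∫ x, Lz φ x * conj (v x)) := by
    rw [← integral_const_mul]
    refine integral_congr_ae ?_
    filter_upwards [Lz_smul_ae c hφ] with x hx
    rw [hx, mul_assoc]
  unfold energyForm
  rw [e1, e2]
  simp only [integral_mul_conj_eq_inner, weakPartial_smul c hφ, inner_smul_right,
    ← Finset.mul_sum]
  ring

/-- The energy form is Hermitian. -/
theorem energyForm_conj_symm (hR : RotationBound V Ω) (hφ : φ ∈ X V) (hv : v ∈ X V) :
    energyForm V Ω φ v = conj (energyForm V Ω v φ) := by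
  have e1 : ∫ x, (V x : ℂ) * φ x * conj (v x) = conj (∫ x, (V x : ℂ) * v x * conj (φ x)) := by
    rw [← integral_conj]
    refine integral_congr_ae (.of_forall fun x ↦ ?_)
    simp
    ring
  have e2 : (Ω : ℂ) * ∫ x, Lz φ x * conj (v x) = conj ((Ω : ℂ) * ∫ x, Lz v x * conj (φ x)) := by
    rcases hR with rfl | ⟨γ, C, hγ, -, h⟩
    · simp
    have hγ0 : 0 < γ := (abs_nonneg _).trans_lt hγ
    rw [integral_Lz_mul_conj_symm hγ0 h hφ hv, map_mul, Complex.conj_ofReal]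
  have e3 : (1 / 2 : ℂ) * ∑ i, (∫ x, weakPartial i φ x * conj (weakPartial i v x)) =
      conj ((1 / 2 : ℂ) * ∑ i, (∫ x, weakPartial i v x * conj (weakPartial i φ x))) := by
    rw [map_mul, map_sum]
    simp only [← integral_mul_conj_symm]
    simp [Complex.conj_ofNat]
  unfold energyForm
  rw [e1, e2, e3, map_sub, map_add]

theorem energyForm_self_re (φ : L2 d) : (energyForm V Ω φ φ).re = linearEnergy V Ω φ := by
  have e1 : ∀ i, ∫ x, weakPartial i φ x * conj (weakPartial i φ x) =
      ((‖weakPartial i φ‖ ^ 2 : ℝ) : ℂ) := by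
    intro i
    rw [integral_mul_conj_eq_inner, inner_self_eq_norm_sq_to_K]
    simp
  have e2 : ∫ x, (V x : ℂ) * φ x * conj (φ x) = ((∫ x, V x * ‖φ x‖ ^ 2 : ℝ) : ℂ) := by
    rw [← integral_complex_ofReal]
    refine integral_congr_ae (.of_forall fun x ↦ ?_)
    simp [mul_assoc, Complex.mul_conj']
  have e3 : ∫ x, Lz φ x * conj (φ x) = ∫ x, conj (φ x) * Lz φ x := by simp only [mul_comm]
  unfold energyForm linearEnergy rotationEnergy
  simp only [e1, e2, e3]
  rw [← Complex.ofReal_sum, Complex.sub_re, Complex.add_re, Complex.re_ofReal_mul,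
    Complex.ofReal_re]
  have : (1 / 2 * ((∑ i, ‖weakPartial i φ‖ ^ 2 : ℝ) : ℂ)).re =
      1 / 2 * ∑ i, ‖weakPartial i φ‖ ^ 2 := by
    rw [show (1 / 2 : ℂ) = ((1 / 2 : ℝ) : ℂ) by norm_num, ← Complex.ofReal_mul, Complex.ofReal_re]
  rw [this]
  ring

theorem energyForm_smul_right (hR : RotationBound V Ω) (c : ℂ) (hφ : φ ∈ X V) (hv : v ∈ X V) :
    energyForm V Ω φ (c • v) = conj c * energyForm V Ω φ v := by
  rw [energyForm_conj_symm hR hφ (X.smul_mem c hv), energyForm_smul_left c hv, map_mul,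
    ← energyForm_conj_symm hR hφ hv]

/-- Expansion of the quadratic form along a line. -/
theorem linearEnergy_add_smul (hV : Measurable V) (hV0 : ∀ x, 0 ≤ V x) (hR : RotationBound V Ω)
    (hφ : φ ∈ X V) (hv : v ∈ X V) (t : ℝ) :
    linearEnergy V Ω (φ + (t : ℂ) • v) = linearEnergy V Ω φ
      + 2 * t * (energyForm V Ω φ v).re + t ^ 2 * linearEnergy V Ω v := by
  have htv := X.smul_mem (t : ℂ) hv
  have hs := X.add_mem hV hV0 hφ htv
  have e1 : energyForm V Ω φ (φ + (t : ℂ) • v) =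
      energyForm V Ω φ φ + t * energyForm V Ω φ v := by
    rw [energyForm_conj_symm hR hφ hs, energyForm_add_left hV hV0 hR hφ htv hφ,
      energyForm_smul_left _ hv, map_add, map_mul, Complex.conj_ofReal,
      ← energyForm_conj_symm hR hφ hφ, ← energyForm_conj_symm hR hφ hv]
  have e2 : energyForm V Ω v (φ + (t : ℂ) • v) =
      conj (energyForm V Ω φ v) + t * energyForm V Ω v v := by
    rw [energyForm_conj_symm hR hv hs, energyForm_add_left hV hV0 hR hφ htv hv,
      energyForm_smul_left _ hv, map_add, map_mul, Complex.conj_ofReal,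
      ← energyForm_conj_symm hR hv hv]
  rw [← energyForm_self_re, energyForm_add_left hV hV0 hR hφ htv hs, energyForm_smul_left _ hv,
    e1, e2, ← energyForm_self_re φ, ← energyForm_self_re v]
  simp only [Complex.add_re, Complex.re_ofReal_mul, Complex.conj_re]
  ring

theorem norm_add_smul_sq (φ v : L2 d) (t : ℝ) :
    ‖φ + (t : ℂ) • v‖ ^ 2 = ‖φ‖ ^ 2 + 2 * t * (inner ℂ v φ).re + t ^ 2 * ‖v‖ ^ 2 := by
  have h : (inner ℂ φ v).re = (inner ℂ v φ).re := inner_re_symm (𝕜 := ℂ) φ v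
  rw [norm_add_sq (𝕜 := ℂ), norm_smul, mul_pow, inner_smul_right]
  simp [h]
  ring

/-- Parallelogram law for the energy form. -/
theorem linearEnergy_parallelogram (hV : Measurable V) (hV0 : ∀ x, 0 ≤ V x)
    (hR : RotationBound V Ω) (hφ : φ ∈ X V) (hv : v ∈ X V) :
    linearEnergy V Ω (φ + v) + linearEnergy V Ω (φ - v) =
      2 * linearEnergy V Ω φ + 2 * linearEnergy V Ω v := by
  have h1 := linearEnergy_add_smul hV hV0 hR hφ hv 1
  have h2 := linearEnergy_add_smul hV hV0 hR hφ hv (-1)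
  rw [Complex.ofReal_one, one_smul] at h1
  rw [Complex.ofReal_neg, Complex.ofReal_one, neg_one_smul, ← sub_eq_add_neg] at h2
  rw [h1, h2]
  ring

theorem linearEnergy_eq (V : Space d → ℝ) (Ω : ℝ) (φ : L2 d) :
    linearEnergy V Ω φ = trapEnergy V φ + rotationEnergy Ω φ := rfl

/-- The quadratic form is bounded above and below by the trap energy. -/
theorem exists_linearEnergy_bounds (hV0 : ∀ x, 0 ≤ V x) (hR : RotationBound V Ω) :
    ∃ κ C : ℝ, 0 < κ ∧ 0 ≤ C ∧ ∀ φ ∈ X V, κ * trapEnergy V φ ≤ linearEnergy V Ω φ + C * ‖φ‖ ^ 2 ∧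
      linearEnergy V Ω φ ≤ 2 * trapEnergy V φ + C * ‖φ‖ ^ 2 := by
  obtain ⟨θ, C, h0, h1, hC, h⟩ := exists_abs_rotationEnergy_le hV0 hR
  refine ⟨1 - θ, C, by linarith, hC, fun φ hφ ↦ ?_⟩
  obtain ⟨h2, h3⟩ := abs_le.mp (h φ hφ)
  have ht := trapEnergy_nonneg hV0 φ
  have hn : 0 ≤ C * ‖φ‖ ^ 2 := by positivity
  rw [linearEnergy_eq]
  constructor
  · nlinarith
  · nlinarith

end

/-! ### Completeness, lower semicontinuity and coercivity -/

section

variable {d : ℕ} {V : Space d → ℝ} {Ω p β : ℝ} {φ ψ v : L2 d}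

theorem cauchySeq_of_norm_sub_sq_le {E : Type*} [NormedAddCommGroup E] {a : ℕ → E} {b : ℕ → ℝ}
    (h : ∀ m n, ‖a m - a n‖ ^ 2 ≤ b m + b n) (hb : Tendsto b atTop (𝓝 0)) : CauchySeq a := by
  rw [Metric.cauchySeq_iff]
  intro ε hε
  obtain ⟨n₀, hn₀⟩ :=
    (hb.eventually (gt_mem_nhds (by positivity : 0 < ε ^ 2 / 2))).exists_forall_of_atTop
  refine ⟨n₀, fun m hm n hn ↦ ?_⟩
  rw [dist_eq_norm]
  refine lt_of_pow_lt_pow_left₀ 2 hε.le ?_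
  linarith [h m n, hn₀ m hm, hn₀ n hn]

theorem exists_subseq_tendsto_ae {f : ℕ → L2 d} {g : L2 d} (h : Tendsto f atTop (𝓝 g)) :
    ∃ k : ℕ → ℕ, StrictMono k ∧ ∀ᵐ x, Tendsto (fun n ↦ f (k n) x) atTop (𝓝 (g x)) :=
  (tendstoInMeasure_of_tendsto_Lp h).exists_seq_tendsto_ae

/-- The form domain is complete for the trap energy. -/
theorem X.of_tendsto (hV : Measurable V) (hV0 : ∀ x, 0 ≤ V x) {w : ℕ → L2 d} {b : ℕ → ℝ}
    (hw : ∀ n, w n ∈ X V) (hlim : Tendsto w atTop (𝓝 φ))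
    (hc : ∀ m n, trapEnergy V (w m - w n) ≤ b m + b n) (hb : Tendsto b atTop (𝓝 0)) :
    φ ∈ X V ∧ Tendsto (fun n ↦ trapEnergy V (w n - φ)) atTop (𝓝 0) := by
  have hD : ∀ i, ∃ g, Tendsto (fun n ↦ weakPartial i (w n)) atTop (𝓝 g) := fun i ↦ by
    refine cauchySeq_tendsto_of_complete
      (cauchySeq_of_norm_sub_sq_le (b := fun n ↦ 2 * b n) (fun m n ↦ ?_) ?_)
    · rw [← weakPartial_sub (hw m) (hw n)]
      linarith [norm_weakPartial_sq_le hV0 (w m - w n) i, hc m n]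
    · simpa using hb.const_mul 2
  choose g hg using hD
  have hφg : ∀ i, IsWeakPartial i φ (g i) := fun i ↦
    IsWeakPartial.of_tendsto (fun n ↦ X.isWeakPartial (hw n) i) hlim (hg i)
  have hsq : ∀ x, √(V x) ^ 2 = V x := fun x ↦ Real.sq_sqrt (hV0 x)
  have hnsq : ∀ x (z : ℂ), ‖(√(V x) : ℂ) * z‖ ^ 2 = V x * ‖z‖ ^ 2 := fun x z ↦ by
    rw [norm_mul, mul_pow, Complex.norm_real, Real.norm_eq_abs, sq_abs, hsq]
  have hmem : ∀ n, MemLp (fun x ↦ (√(V x) : ℂ) * w n x) 2 := fun n ↦ by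
    have hm : AEStronglyMeasurable fun x ↦ (√(V x) : ℂ) * w n x :=
      (Complex.measurable_ofReal.comp hV.sqrt).aestronglyMeasurable.mul (Lp.aestronglyMeasurable _)
    rw [memLp_two_iff_integrable_sq_norm hm]
    simpa only [hnsq] using (hw n).2
  set y : ℕ → L2 d := fun n ↦ (hmem n).toLp _
  have hyc : CauchySeq y := by
    refine cauchySeq_of_norm_sub_sq_le (b := b) (fun m n ↦ ?_) hb
    refine le_trans (le_of_eq ?_) ((integral_potential_le (V := V) (w m - w n)).trans (hc m n))
    rw [← integral_norm_sq_eq]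
    refine integral_congr_ae ?_
    filter_upwards [Lp.coeFn_sub (y m) (y n), Lp.coeFn_sub (w m) (w n), (hmem m).coeFn_toLp,
      (hmem n).coeFn_toLp] with x h1 h2 h3 h4
    rw [h1, h2, Pi.sub_apply, Pi.sub_apply, h3, h4, ← mul_sub, hnsq]
  obtain ⟨G, hG⟩ := cauchySeq_tendsto_of_complete hyc
  -- the limit of `√V w_n` is identified along an almost everywhere convergent subsequence
  have hGφ : G =ᵐ[volume] fun x ↦ (√(V x) : ℂ) * φ x := by
    obtain ⟨k, hk, hk1⟩ := exists_subseq_tendsto_ae hG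
    obtain ⟨j, hj, hj1⟩ := exists_subseq_tendsto_ae (hlim.comp hk.tendsto_atTop)
    filter_upwards [hk1, hj1, ae_all_iff.mpr fun n ↦ (hmem n).coeFn_toLp] with x h1 h2 h3
    refine tendsto_nhds_unique (h1.comp hj.tendsto_atTop) ((h2.const_mul (√(V x) : ℂ)).congr ?_)
    exact fun n ↦ (h3 _).symm
  have hφX : φ ∈ X V := by
    refine ⟨fun i ↦ ⟨g i, hφg i⟩, (integrable_norm_sq G).congr ?_⟩
    filter_upwards [hGφ] with x hx
    rw [hx, hnsq]
  refine ⟨hφX, ?_⟩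
  have e : ∀ n, trapEnergy V (w n - φ) =
      1 / 2 * ∑ i, ‖weakPartial i (w n) - g i‖ ^ 2 + ‖y n - G‖ ^ 2 := fun n ↦ by
    unfold trapEnergy
    congr 1
    · simp only [weakPartial_sub (hw n) hφX, weakPartial_eq (hφg _)]
    · rw [← integral_norm_sq_eq]
      refine integral_congr_ae ?_
      filter_upwards [Lp.coeFn_sub (y n) G, Lp.coeFn_sub (w n) φ, (hmem n).coeFn_toLp,
        hGφ] with x h1 h2 h3 h4
      rw [h1, h2, Pi.sub_apply, Pi.sub_apply, h3, h4, ← mul_sub, hnsq]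
  simp only [e]
  have t1 : ∀ i, Tendsto (fun n ↦ ‖weakPartial i (w n) - g i‖ ^ 2) atTop (𝓝 0) := fun i ↦ by
    simpa using ((tendsto_iff_norm_sub_tendsto_zero.mp (hg i)).pow 2)
  have t2 : Tendsto (fun n ↦ ‖y n - G‖ ^ 2) atTop (𝓝 0) := by
    simpa using ((tendsto_iff_norm_sub_tendsto_zero.mp hG).pow 2)
  have t3 := (tendsto_finsetSum Finset.univ fun i _ ↦ t1 i).const_mul (1 / 2)
  simpa using t3.add t2

/-- Lower semicontinuity of the interaction energy under convergence in `L²`. -/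
theorem integral_norm_rpow_le_of_tendsto {q L : ℝ} (hq : 0 < q) {w : ℕ → L2 d}
    (hlim : Tendsto w atTop (𝓝 φ)) (hi : ∀ n, Integrable fun x ↦ ‖w n x‖ ^ q)
    (hφ : Integrable fun x ↦ ‖φ x‖ ^ q)
    (hL : Tendsto (fun n ↦ ∫ x, ‖w n x‖ ^ q) atTop (𝓝 L)) : ∫ x, ‖φ x‖ ^ q ≤ L := by
  obtain ⟨k, hk, hae⟩ := exists_subseq_tendsto_ae hlim
  have hL0 : 0 ≤ L := ge_of_tendsto' hL fun n ↦ integral_nonneg fun x ↦ by positivity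
  have h1 : ∫⁻ x, ENNReal.ofReal (‖φ x‖ ^ q) ≤
      liminf (fun n ↦ ∫⁻ x, ENNReal.ofReal (‖w (k n) x‖ ^ q)) atTop := by
    refine le_trans (le_of_eq ?_)
      (lintegral_liminf_le' fun n ↦ (hi (k n)).aestronglyMeasurable.aemeasurable.ennreal_ofReal)
    refine lintegral_congr_ae ?_
    filter_upwards [hae] with x hx
    have : Tendsto (fun n ↦ ENNReal.ofReal (‖w (k n) x‖ ^ q)) atTop
        (𝓝 (ENNReal.ofReal (‖φ x‖ ^ q))) :=
      (ENNReal.continuous_ofReal.tendsto _).comp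
        (((Real.continuous_rpow_const hq.le).tendsto _).comp hx.norm)
    exact this.liminf_eq.symm
  have h2 : ∀ n, ∫⁻ x, ENNReal.ofReal (‖w n x‖ ^ q) = ENNReal.ofReal (∫ x, ‖w n x‖ ^ q) := fun n ↦
    (ofReal_integral_eq_lintegral_ofReal (hi n) (.of_forall fun x ↦ by positivity)).symm
  have h3 : Tendsto (fun n ↦ ∫⁻ x, ENNReal.ofReal (‖w (k n) x‖ ^ q)) atTop
      (𝓝 (ENNReal.ofReal L)) := by
    simp only [h2]
    exact (ENNReal.continuous_ofReal.tendsto _).comp (hL.comp hk.tendsto_atTop)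
  rw [h3.liminf_eq, ← ofReal_integral_eq_lintegral_ofReal hφ (.of_forall fun x ↦ by positivity)]
    at h1
  exact (ENNReal.ofReal_le_ofReal_iff hL0).mp h1

/-- The action controls the trap energy and the mass: where `V` is large it absorbs the negative
quadratic terms, elsewhere the superquadratic interaction does. -/
theorem exists_action_coercive (hV0 : ∀ x, 0 ≤ V x) (hVc : Tendsto V (cocompact (Space d)) atTop)
    (hR : RotationBound V Ω) (hp : 1 < p) (hβ : 0 < β)
    (hint : ∀ φ ∈ X V, Integrable fun x ↦ ‖φ x‖ ^ (p + 1)) (ω : ℝ) :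
    ∃ κ C : ℝ, 0 < κ ∧ ∀ φ ∈ X V,
      κ * (trapEnergy V φ + ‖φ‖ ^ 2) - C ≤ action V p β Ω ω φ := by
  obtain ⟨κ₀, C₀, hκ₀, hC₀, hQ⟩ := exists_linearEnergy_bounds hV0 hR
  set Λ := C₀ + |ω| + 1
  have hΛ : 0 < Λ := by positivity
  set c := 2 * β / (p + 1)
  have hc : 0 < c := by
    have : 0 < p + 1 := by linarith
    positivity
  have hp1 : 0 < p - 1 := by linarith
  obtain ⟨R, hR⟩ := exists_forall_notMem_closedBall_le hVc (2 * Λ / κ₀)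
  set s₀ := (Λ / c) ^ (1 / (p - 1))
  have hs₀ : 0 < s₀ := by positivity
  -- above the height `s₀` the interaction dominates `Λ s²`
  have hs : ∀ s : ℝ, 0 ≤ s → Λ * s ^ 2 ≤ c * s ^ (p + 1) + Λ * s₀ ^ 2 := by
    intro s hs
    rcases le_total s s₀ with h | h
    · have h1 : Λ * s ^ 2 ≤ Λ * s₀ ^ 2 := by gcongr
      have h2 : 0 ≤ c * s ^ (p + 1) := by positivity
      linarith
    · have hspos : 0 < s := hs₀.trans_le h
      have h1 : Λ / c ≤ s ^ (p - 1) := by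
        calc Λ / c = s₀ ^ (p - 1) := by
              rw [← Real.rpow_mul (by positivity), one_div_mul_cancel hp1.ne', Real.rpow_one]
          _ ≤ _ := by gcongr
      have h2 : s ^ (p + 1) = s ^ (p - 1) * s ^ 2 := by
        rw [← Real.rpow_two, ← Real.rpow_add hspos]
        ring_nf
      rw [div_le_iff₀ hc] at h1
      have h3 := mul_le_mul_of_nonneg_right h1 (sq_nonneg s)
      have h4 : 0 ≤ Λ * s₀ ^ 2 := by positivity
      rw [h2]
      linarith
  set D := ∫ x, (Metric.closedBall (0 : Space d) R).indicator (fun _ ↦ Λ * s₀ ^ 2) x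
  refine ⟨min (κ₀ / 2) 1, D, by positivity, fun φ hφ ↦ ?_⟩
  have hI : Integrable ((Metric.closedBall (0 : Space d) R).indicator (fun _ ↦ Λ * s₀ ^ 2)) := by
    rw [integrable_indicator_iff measurableSet_closedBall]
    exact integrableOn_const measure_closedBall_lt_top.ne
  have i1 := hφ.2.const_mul (κ₀ / 2)
  have i2 := (hint φ hφ).const_mul c
  have hpt : ∀ x, Λ * ‖φ x‖ ^ 2 ≤ κ₀ / 2 * (V x * ‖φ x‖ ^ 2) + c * ‖φ x‖ ^ (p + 1)
      + (Metric.closedBall (0 : Space d) R).indicator (fun _ ↦ Λ * s₀ ^ 2) x := by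
    intro x
    have hVx : 0 ≤ κ₀ / 2 * (V x * ‖φ x‖ ^ 2) :=
      mul_nonneg (by positivity) (mul_nonneg (hV0 x) (by positivity))
    have hc' : 0 ≤ c * ‖φ x‖ ^ (p + 1) := by positivity
    by_cases hx : x ∈ Metric.closedBall (0 : Space d) R
    · rw [Set.indicator_of_mem hx]
      linarith [hs ‖φ x‖ (norm_nonneg _)]
    · rw [Set.indicator_of_notMem hx]
      have h1 := hR x hx
      rw [div_le_iff₀ hκ₀] at h1
      have h2 := mul_le_mul_of_nonneg_right h1 (sq_nonneg ‖φ x‖)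
      linarith
  have h1 := integral_mono ((integrable_norm_sq φ).const_mul Λ) ((i1.add i2).add hI) hpt
  rw [integral_add' (i1.add i2) hI, integral_add' i1 i2] at h1
  simp only [integral_const_mul, integral_norm_sq_eq] at h1
  have h2 := (hQ φ hφ).1
  have h3 := integral_potential_le (V := V) φ
  have h4 := mul_le_mul_of_nonneg_left h3 (by positivity : 0 ≤ κ₀ / 2)
  have h5 := trapEnergy_nonneg hV0 φ
  have h6 : -|ω| * ‖φ‖ ^ 2 ≤ ω * ‖φ‖ ^ 2 :=
    mul_le_mul_of_nonneg_right (neg_abs_le ω) (by positivity)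
  have h7 : min (κ₀ / 2) 1 * (trapEnergy V φ + ‖φ‖ ^ 2) ≤
      κ₀ / 2 * trapEnergy V φ + 1 * ‖φ‖ ^ 2 := by
    rw [mul_add]
    gcongr
    · exact min_le_left _ _
    · exact min_le_right _ _
  change _ ≤ linearEnergy V Ω φ + c * (∫ x, ‖φ x‖ ^ (p + 1)) + ω * ‖φ‖ ^ 2
  change Λ * ‖φ‖ ^ 2 ≤ κ₀ / 2 * (∫ x, V x * ‖φ x‖ ^ 2) + c * (∫ x, ‖φ x‖ ^ (p + 1)) + D at h1
  simp only [Λ] at h1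
  linarith

end

/-! ### Existence of action minimizers -/

section

variable {d : ℕ} {V : Space d → ℝ} {Ω p β : ℝ} {φ ψ v : L2 d}

theorem linearEnergy_real_smul (hR : RotationBound V Ω) (hφ : φ ∈ X V) (t : ℝ) :
    linearEnergy V Ω ((t : ℂ) • φ) = t ^ 2 * linearEnergy V Ω φ := by
  rw [← energyForm_self_re, energyForm_smul_left _ hφ, energyForm_smul_right hR _ hφ hφ,
    Complex.conj_ofReal, Complex.re_ofReal_mul, Complex.re_ofReal_mul, energyForm_self_re]
  ring

theorem integral_norm_rpow_midpoint_le {q : ℝ} (hq : 1 ≤ q)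
    (hφ : Integrable fun x ↦ ‖φ x‖ ^ q) (hψ : Integrable fun x ↦ ‖ψ x‖ ^ q)
    (hm : Integrable fun x ↦ ‖(((1 / 2 : ℝ) : ℂ) • (φ + ψ) : L2 d) x‖ ^ q) :
    ∫ x, ‖(((1 / 2 : ℝ) : ℂ) • (φ + ψ) : L2 d) x‖ ^ q ≤
      1 / 2 * (∫ x, ‖φ x‖ ^ q) + 1 / 2 * ∫ x, ‖ψ x‖ ^ q := by
  rw [← integral_const_mul, ← integral_const_mul,
    ← integral_add (hφ.const_mul _) (hψ.const_mul _)]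
  refine integral_mono_ae hm ((hφ.const_mul _).add (hψ.const_mul _)) ?_
  filter_upwards [Lp.coeFn_smul ((1 / 2 : ℝ) : ℂ) (φ + ψ), Lp.coeFn_add φ ψ] with x h1 h2
  rw [h1, Pi.smul_apply, h2, Pi.add_apply, norm_smul, Complex.norm_real]
  have hconv := (convexOn_rpow hq).2 (norm_nonneg (φ x)) (norm_nonneg (ψ x))
    (by norm_num : (0 : ℝ) ≤ 1 / 2) (by norm_num : (0 : ℝ) ≤ 1 / 2) (by norm_num)
  refine le_trans ?_ hconv
  simp only [smul_eq_mul]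
  rw [← mul_add, Real.norm_of_nonneg (by norm_num : (0 : ℝ) ≤ 1 / 2)]
  gcongr
  exact norm_add_le _ _

/-- Uniform convexity of the action up to an `L²` term: the parallelogram law for the quadratic part
and convexity of the interaction. -/
theorem action_midpoint_add_le (hV : Measurable V) (hV0 : ∀ x, 0 ≤ V x) (hR : RotationBound V Ω)
    (hp : 1 < p) (hβ : 0 < β) (hint : ∀ φ ∈ X V, Integrable fun x ↦ ‖φ x‖ ^ (p + 1)) (ω : ℝ)
    (hφ : φ ∈ X V) (hψ : ψ ∈ X V) :
    action V p β Ω ω (((1 / 2 : ℝ) : ℂ) • (φ + ψ))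
      + 1 / 4 * (linearEnergy V Ω (φ - ψ) + ω * ‖φ - ψ‖ ^ 2) ≤
      1 / 2 * (action V p β Ω ω φ + action V p β Ω ω ψ) := by
  have hs := X.add_mem hV hV0 hφ hψ
  have hd := X.sub_mem hV hV0 hφ hψ
  have hm := X.smul_mem ((1 / 2 : ℝ) : ℂ) hs
  have h1 := linearEnergy_parallelogram hV hV0 hR hφ hψ
  have h2 := linearEnergy_real_smul hR hs (1 / 2)
  have h3 := integral_norm_rpow_midpoint_le (by linarith : 1 ≤ p + 1) (hint φ hφ) (hint ψ hψ)
    (hint _ hm)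
  have h4 : ‖((1 / 2 : ℝ) : ℂ) • (φ + ψ)‖ ^ 2 = 1 / 4 * ‖φ + ψ‖ ^ 2 := by
    rw [norm_smul, mul_pow, Complex.norm_real]
    norm_num
  have h5 := parallelogram_law_with_norm ℂ φ ψ
  have hc : 0 ≤ 2 * β / (p + 1) := by
    have : 0 < p + 1 := by linarith
    positivity
  have h6 := mul_le_mul_of_nonneg_left h3 hc
  unfold action energy
  rw [h2, h4]
  have h7 : ω * (‖φ + ψ‖ ^ 2 + ‖φ - ψ‖ ^ 2) = ω * (2 * (‖φ‖ ^ 2 + ‖ψ‖ ^ 2)) := by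
    linear_combination ω * h5
  linarith

/-- The quadratic form is continuous on the form domain, by Cauchy-Schwarz for the nonnegative form
obtained by adding a multiple of the mass. -/
theorem tendsto_linearEnergy (hV : Measurable V) (hV0 : ∀ x, 0 ≤ V x) (hR : RotationBound V Ω)
    {w : ℕ → L2 d} (hw : ∀ n, w n ∈ X V) (hφ : φ ∈ X V) (hlim : Tendsto w atTop (𝓝 φ))
    (ht : Tendsto (fun n ↦ trapEnergy V (w n - φ)) atTop (𝓝 0)) :
    Tendsto (fun n ↦ linearEnergy V Ω (w n)) atTop (𝓝 (linearEnergy V Ω φ)) := by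
  obtain ⟨κ, C, hκ, hC, hQ⟩ := exists_linearEnergy_bounds hV0 hR
  have ha0 : ∀ x ∈ X V, 0 ≤ linearEnergy V Ω x + C * ‖x‖ ^ 2 := fun x hx ↦
    (mul_nonneg hκ.le (trapEnergy_nonneg hV0 x)).trans (hQ x hx).1
  have hδ : ∀ n, w n - φ ∈ X V := fun n ↦ X.sub_mem hV hV0 (hw n) hφ
  set b : ℕ → ℝ := fun n ↦ (energyForm V Ω φ (w n - φ)).re + C * (inner ℂ (w n - φ) φ).re
  set a : L2 d → ℝ := fun x ↦ linearEnergy V Ω x + C * ‖x‖ ^ 2 with ha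
  have hexp : ∀ n (t : ℝ), a (φ + (t : ℂ) • (w n - φ)) =
      a φ + 2 * t * b n + t ^ 2 * a (w n - φ) := fun n t ↦ by
    simp only [ha, b]
    rw [linearEnergy_add_smul hV hV0 hR hφ (hδ n), norm_add_smul_sq]
    ring
  have hnorm : Tendsto (fun n ↦ ‖w n - φ‖ ^ 2) atTop (𝓝 0) := by
    simpa using (tendsto_iff_norm_sub_tendsto_zero.mp hlim).pow 2
  have haδ : Tendsto (fun n ↦ a (w n - φ)) atTop (𝓝 0) := by
    have hub : Tendsto (fun n ↦ 2 * trapEnergy V (w n - φ) + 2 * C * ‖w n - φ‖ ^ 2)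
        atTop (𝓝 0) := by
      simpa using (ht.const_mul 2).add (hnorm.const_mul (2 * C))
    refine tendsto_of_tendsto_of_tendsto_of_le_of_le tendsto_const_nhds hub
      (fun n ↦ ha0 _ (hδ n)) fun n ↦ ?_
    have := (hQ _ (hδ n)).2
    simp only [ha]
    linarith
  -- Cauchy-Schwarz for the nonnegative form `a`
  have hCS : ∀ n, b n ^ 2 ≤ a φ * a (w n - φ) := fun n ↦ by
    have := discrim_le_zero (a := a (w n - φ)) (b := 2 * b n) (c := a φ) fun t ↦ by
      have h1 := ha0 _ (X.add_mem hV hV0 hφ (X.smul_mem (t : ℂ) (hδ n)))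
      have h2 := hexp n t
      simp only [ha] at h2 ⊢
      rw [h2] at h1
      linarith
    rw [discrim] at this
    linarith
  have hb : Tendsto b atTop (𝓝 0) := by
    have h1 : Tendsto (fun n ↦ b n ^ 2) atTop (𝓝 0) :=
      tendsto_of_tendsto_of_tendsto_of_le_of_le tendsto_const_nhds
        (by simpa using haδ.const_mul (a φ)) (fun n ↦ sq_nonneg _) hCS
    have h2 := h1.sqrt
    simp only [Real.sqrt_sq_eq_abs, Real.sqrt_zero] at h2
    exact (tendsto_zero_iff_abs_tendsto_zero _).mpr h2
  have haw : Tendsto (fun n ↦ a (w n)) atTop (𝓝 (a φ)) := by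
    have h1 : ∀ n, a (w n) = a φ + 2 * b n + a (w n - φ) := fun n ↦ by
      have := hexp n 1
      simp only [Complex.ofReal_one, one_smul, add_sub_cancel] at this
      rw [this]
      ring
    simp only [h1]
    simpa using ((hb.const_mul 2).const_add (a φ)).add haδ
  have := haw.sub ((hlim.norm.pow 2).const_mul C)
  simpa [ha] using this

/-- The action attains its infimum over the form domain. -/
theorem exists_action_minimizer (hV : Measurable V) (hV0 : ∀ x, 0 ≤ V x)
    (hVc : Tendsto V (cocompact (Space d)) atTop) (hR : RotationBound V Ω) (hp : 1 < p)
    (hβ : 0 < β) (hint : ∀ φ ∈ X V, Integrable fun x ↦ ‖φ x‖ ^ (p + 1)) (ω : ℝ)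
    (hne : (X V).Nonempty) :
    ∃ φ ∈ X V, ∀ ψ ∈ X V, action V p β Ω ω φ ≤ action V p β Ω ω ψ := by
  obtain ⟨κ, C, hκ, hco⟩ := exists_action_coercive hV0 hVc hR hp hβ hint ω
  obtain ⟨κ₁, C₁, hκ₁, hC₁, hQ⟩ := exists_linearEnergy_bounds hV0 hR
  set S := action V p β Ω ω
  have hbdd : BddBelow (S '' X V) := by
    refine ⟨-C, ?_⟩
    rintro _ ⟨φ, hφ, rfl⟩
    have h1 : 0 ≤ κ * (trapEnergy V φ + ‖φ‖ ^ 2) :=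
      mul_nonneg hκ.le (add_nonneg (trapEnergy_nonneg hV0 φ) (by positivity))
    linarith [hco φ hφ]
  set s := sInf (S '' X V)
  have hs : ∀ ψ ∈ X V, s ≤ S ψ := fun ψ hψ ↦ csInf_le hbdd ⟨ψ, hψ, rfl⟩
  obtain ⟨a, ha, hlim, hmem⟩ := exists_seq_tendsto_sInf (hne.image S) hbdd
  choose u hu hua using hmem
  set M₀ := (a 0 + C) / κ
  have hM₀ : ∀ n, trapEnergy V (u n) + ‖u n‖ ^ 2 ≤ M₀ := fun n ↦ by
    rw [le_div_iff₀ hκ]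
    have h1 := hco (u n) (hu n)
    have h2 := ha (Nat.zero_le n)
    rw [← hua n] at h2
    linarith
  have hT : ∀ n, trapEnergy V (u n) ≤ M₀ := fun n ↦ by
    have := hM₀ n
    have h2 := sq_nonneg ‖u n‖
    linarith
  have hM₀0 : 0 ≤ M₀ := (trapEnergy_nonneg hV0 _).trans (hT 0)
  obtain ⟨φ, k, hk, hφ⟩ := exists_subseq_tendsto (M := 2 * M₀ + 1) hV0 hVc
    (fun n i ↦ X.isWeakPartial (hu n) i)
    (fun n ↦ by
      have h1 := hM₀ n
      have h2 := trapEnergy_nonneg hV0 (u n)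
      nlinarith [sq_nonneg (‖u n‖ - 1)])
    (fun n i ↦ by
      have h1 := norm_weakPartial_sq_le hV0 (u n) i
      have h2 := hT n
      nlinarith [sq_nonneg (‖weakPartial i (u n)‖ - 1)])
    (fun n ↦ (hu n).2)
    (fun n ↦ by
      have h1 := integral_potential_le (V := V) (u n)
      have h2 := hT n
      linarith)
  set w := fun n ↦ u (k n)
  have hw : ∀ n, w n ∈ X V := fun n ↦ hu (k n)
  have hSw : Tendsto (fun n ↦ S (w n)) atTop (𝓝 s) := by
    have := hlim.comp hk.tendsto_atTop
    refine this.congr fun n ↦ ?_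
    exact (hua (k n)).symm
  have hnorm : Tendsto (fun n ↦ ‖w n - φ‖ ^ 2) atTop (𝓝 0) := by
    simpa using (tendsto_iff_norm_sub_tendsto_zero.mp hφ).pow 2
  set b : ℕ → ℝ := fun n ↦ κ₁⁻¹ * (2 * (S (w n) - s) + 2 * (|ω| + C₁) * ‖w n - φ‖ ^ 2)
  have hb : Tendsto b atTop (𝓝 0) := by
    have h1 : Tendsto (fun n ↦ S (w n) - s) atTop (𝓝 0) := by simpa using hSw.sub_const s
    simpa using ((h1.const_mul 2).add (hnorm.const_mul (2 * (|ω| + C₁)))).const_mul κ₁⁻¹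
  -- the midpoint of `w m` and `w n` does not beat the infimum, so `w m - w n` has small energy
  have hc : ∀ m n, trapEnergy V (w m - w n) ≤ b m + b n := by
    intro m n
    have hδ := X.sub_mem hV hV0 (hw m) (hw n)
    have h1 := action_midpoint_add_le hV hV0 hR hp hβ hint ω (hw m) (hw n)
    have h2 := hs _ (X.smul_mem ((1 / 2 : ℝ) : ℂ) (X.add_mem hV hV0 (hw m) (hw n)))
    have h3 := (hQ _ hδ).1
    have h4 : ‖w m - w n‖ ^ 2 ≤ 2 * ‖w m - φ‖ ^ 2 + 2 * ‖w n - φ‖ ^ 2 := by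
      have h5 := norm_sub_le (w m - φ) (w n - φ)
      rw [sub_sub_sub_cancel_right] at h5
      nlinarith [sq_nonneg (‖w m - φ‖ - ‖w n - φ‖), norm_nonneg (w m - w n),
        norm_nonneg (w m - φ), norm_nonneg (w n - φ)]
    have h6 : -(|ω| * ‖w m - w n‖ ^ 2) ≤ ω * ‖w m - w n‖ ^ 2 := by
      have := mul_le_mul_of_nonneg_right (neg_abs_le ω) (sq_nonneg ‖w m - w n‖)
      linarith
    have h7 := mul_le_mul_of_nonneg_left h4 (by positivity : 0 ≤ |ω| + C₁)
    have h8 : b m + b n = κ₁⁻¹ * (2 * (S (w m) - s) + 2 * (|ω| + C₁) * ‖w m - φ‖ ^ 2 +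
        (2 * (S (w n) - s) + 2 * (|ω| + C₁) * ‖w n - φ‖ ^ 2)) := (mul_add _ _ _).symm
    rw [h8, ← div_eq_inv_mul, le_div_iff₀' hκ₁]
    linarith
  obtain ⟨hφX, ht⟩ := X.of_tendsto hV hV0 hw hφ hc hb
  refine ⟨φ, hφX, fun ψ hψ ↦ le_trans ?_ (hs ψ hψ)⟩
  have hcpos : 0 < 2 * β / (p + 1) := by
    have : 0 < p + 1 := by linarith
    positivity
  have hQlim := tendsto_linearEnergy hV hV0 hR hw hφX hφ ht
  -- the interaction energies converge since all other terms do; then Fatou's lemma applies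
  have hP : Tendsto (fun n ↦ ∫ x, ‖w n x‖ ^ (p + 1)) atTop
      (𝓝 ((2 * β / (p + 1))⁻¹ * (s - linearEnergy V Ω φ - ω * ‖φ‖ ^ 2))) := by
    refine (((hSw.sub hQlim).sub ((hφ.norm.pow 2).const_mul ω)).const_mul
      (2 * β / (p + 1))⁻¹).congr fun n ↦ ?_
    simp only [S, action, energy]
    rw [inv_mul_eq_iff_eq_mul₀ hcpos.ne']
    ring
  have hF := integral_norm_rpow_le_of_tendsto (by linarith) hφ (fun n ↦ hint _ (hw n))
    (hint _ hφX) hP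
  rw [← div_eq_inv_mul, le_div_iff₀' hcpos] at hF
  simp only [S, action, energy]
  linarith

end

/-! ### The Euler-Lagrange equation and action ground states -/

section

variable {d : ℕ} {V : Space d → ℝ} {Ω p β ω : ℝ} {φ ψ v : L2 d}

theorem integrable_add_norm_rpow {q : ℝ} (hq : 0 < q) (hφ : Integrable fun x ↦ ‖φ x‖ ^ q)
    (hv : Integrable fun x ↦ ‖v x‖ ^ q) : Integrable fun x ↦ (‖φ x‖ + ‖v x‖) ^ q := by
  have key : ∀ f : L2 d, Integrable (fun x ↦ ‖f x‖ ^ q) → MemLp f (ENNReal.ofReal q) :=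
    fun f hf ↦ by
    rw [← integrable_norm_rpow_iff (Lp.aestronglyMeasurable f) (by simpa using hq)
      ENNReal.ofReal_ne_top, ENNReal.toReal_ofReal hq.le]
    exact hf
  have h1 := ((key φ hφ).norm.add (key v hv).norm).integrable_norm_rpow (by simpa using hq)
    ENNReal.ofReal_ne_top
  rw [ENNReal.toReal_ofReal hq.le] at h1
  refine h1.congr (.of_forall fun x ↦ ?_)
  simp only [Pi.add_apply]
  rw [Real.norm_of_nonneg (by positivity)]

theorem rpow_sub_two_mul_mul_le {q a b m : ℝ} (hq : 2 < q) (ha : 0 ≤ a) (hb : 0 ≤ b) (ham : a ≤ m)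
    (hbm : b ≤ m) : a ^ (q - 2) * (a * b) ≤ m ^ q := by
  have hm : 0 ≤ m := ha.trans ham
  have e : m ^ (q - 2) * (m * m) = m ^ q := by
    rw [← sq, ← Real.rpow_two, ← Real.rpow_add' hm (by linarith)]
    ring_nf
  rw [← e]
  gcongr

/-- Derivative of the interaction energy along a line. -/
theorem hasDerivAt_integral_norm_rpow {q : ℝ} (hq : 2 < q) (hφ : Integrable fun x ↦ ‖φ x‖ ^ q)
    (hv : Integrable fun x ↦ ‖v x‖ ^ q) :
    HasDerivAt (fun t : ℝ ↦ ∫ x, ‖φ x + (t : ℂ) * v x‖ ^ q)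
      (∫ x, q * ‖φ x‖ ^ (q - 2) * (φ x * conj (v x)).re) 0 := by
  have hm : ∀ t : ℝ, AEStronglyMeasurable fun x ↦ φ x + (t : ℂ) * v x := fun t ↦
    (Lp.aestronglyMeasurable φ).add ((Lp.aestronglyMeasurable v).const_mul _)
  have hre : ∀ z y : ℂ, inner ℝ z y = (z * conj y).re := fun z y ↦ by
    rw [Complex.inner, ← Complex.conj_re]
    simp [mul_comm]
  have h := hasDerivAt_integral_of_dominated_loc_of_deriv_le (μ := volume)
    (F := fun (t : ℝ) (x : Space d) ↦ ‖φ x + (t : ℂ) * v x‖ ^ q)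
    (F' := fun t x ↦ q * ‖φ x + (t : ℂ) * v x‖ ^ (q - 2) * inner ℝ (φ x + (t : ℂ) * v x) (v x))
    (x₀ := (0 : ℝ)) (s := Metric.ball 0 1) (bound := fun x ↦ q * (‖φ x‖ + ‖v x‖) ^ q)
    (Metric.ball_mem_nhds _ one_pos) (.of_forall fun t ↦ ?_) ?_ ?_ (.of_forall fun x t ht ↦ ?_)
    ((integrable_add_norm_rpow (by linarith) hφ hv).const_mul q) (.of_forall fun x t ht ↦ ?_)
  · simpa [hre] using h.2
  · exact (Real.continuous_rpow_const (by linarith)).comp_aestronglyMeasurable (hm t).norm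
  · simpa using hφ
  · exact (((Real.continuous_rpow_const (by linarith)).comp_aestronglyMeasurable
      (hm 0).norm).const_mul q).mul ((hm 0).inner (Lp.aestronglyMeasurable v))
  · have ht1 : |t| ≤ 1 := by
      rw [Metric.mem_ball, dist_zero_right, Real.norm_eq_abs] at ht
      exact ht.le
    have hb : ‖φ x + (t : ℂ) * v x‖ ≤ ‖φ x‖ + ‖v x‖ := by
      refine (norm_add_le _ _).trans ?_
      rw [norm_mul, Complex.norm_real, Real.norm_eq_abs]
      nlinarith [norm_nonneg (v x)]
    rw [norm_mul, norm_mul, Real.norm_of_nonneg (by linarith : 0 ≤ q),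
      Real.norm_of_nonneg (by positivity : 0 ≤ ‖φ x + (t : ℂ) * v x‖ ^ (q - 2)), mul_assoc]
    gcongr ?_ * ?_
    refine le_trans ?_ (rpow_sub_two_mul_mul_le hq (norm_nonneg _) (norm_nonneg (v x)) hb
      (le_add_of_nonneg_left (norm_nonneg _)))
    gcongr
    exact norm_inner_le_norm _ _
  · have h1 : HasDerivAt (fun t : ℝ ↦ φ x + (t : ℂ) * v x) (v x) t := by
      simpa using ((Complex.ofRealCLM.hasDerivAt (x := t)).mul_const (v x)).const_add (φ x)
    exact (hasFDerivAt_norm_rpow (φ x + (t : ℂ) * v x)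
      (by linarith : 1 < q)).comp_hasDerivAt t h1

/-- The left-hand side of the weak stationary equation, tested against `v`. -/
noncomputable def stationaryForm (V : Space d → ℝ) (p β Ω ω : ℝ) (φ v : L2 d) : ℂ :=
  energyForm V Ω φ v + (β : ℂ) * (∫ x, ((‖φ x‖ ^ (p - 1) : ℝ) : ℂ) * φ x * conj (v x))
    + (ω : ℂ) * (∫ x, φ x * conj (v x))

theorem mem_stationarySolutions_iff : φ ∈ stationarySolutions V p β Ω ω ↔
    φ ∈ X V ∧ φ ≠ 0 ∧ ∀ v ∈ X V, stationaryForm V p β Ω ω φ v = 0 := by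
  have h : ∀ v, stationaryForm V p β Ω ω φ v =
      1 / 2 * ∑ i, (∫ x, weakPartial i φ x * starRingEnd ℂ (weakPartial i v x))
      + (∫ x, (V x : ℂ) * φ x * starRingEnd ℂ (v x))
      + (β : ℂ) * (∫ x, ((‖φ x‖ ^ (p - 1) : ℝ) : ℂ) * φ x * starRingEnd ℂ (v x))
      - (Ω : ℂ) * (∫ x, Lz φ x * starRingEnd ℂ (v x))
      + (ω : ℂ) * (∫ x, φ x * starRingEnd ℂ (v x)) := fun v ↦ by
    rw [stationaryForm, energyForm]
    ring
  simp only [h]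
  rfl

theorem stationaryForm_smul_right (hR : RotationBound V Ω) (c : ℂ) (hφ : φ ∈ X V) (hv : v ∈ X V) :
    stationaryForm V p β Ω ω φ (c • v) = conj c * stationaryForm V p β Ω ω φ v := by
  have e : ∀ f : Space d → ℂ, ∫ x, f x * conj ((c • v : L2 d) x) =
      conj c * ∫ x, f x * conj (v x) := by
    intro f
    rw [← integral_const_mul]
    refine integral_congr_ae ?_
    filter_upwards [Lp.coeFn_smul c v] with x hx
    rw [hx, Pi.smul_apply, smul_eq_mul, map_mul]
    ring
  rw [stationaryForm, stationaryForm, energyForm_smul_right hR c hφ hv, e, e]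
  ring

theorem integrable_interaction (hp : 1 < p) (hφ : Integrable fun x ↦ ‖φ x‖ ^ (p + 1))
    (hv : Integrable fun x ↦ ‖v x‖ ^ (p + 1)) :
    Integrable fun x ↦ ((‖φ x‖ ^ (p - 1) : ℝ) : ℂ) * φ x * conj (v x) := by
  refine (integrable_add_norm_rpow (by linarith) hφ hv).mono' ?_ (.of_forall fun x ↦ ?_)
  · refine ((Complex.continuous_ofReal.comp_aestronglyMeasurable
      ((Real.continuous_rpow_const (by linarith)).comp_aestronglyMeasurable
        (Lp.aestronglyMeasurable φ).norm)).mul (Lp.aestronglyMeasurable φ)).mul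
        (Lp.aestronglyMeasurable v).star
  · rw [norm_mul, norm_mul, RCLike.norm_conj, Complex.norm_real,
      Real.norm_of_nonneg (by positivity), mul_assoc, show p - 1 = p + 1 - 2 by ring]
    exact rpow_sub_two_mul_mul_le (by linarith) (norm_nonneg _) (norm_nonneg _)
      (le_add_of_nonneg_right (norm_nonneg _)) (le_add_of_nonneg_left (norm_nonneg _))

/-- The derivative of the action is twice the real part of the stationary form. -/
theorem hasDerivAt_action (hV : Measurable V) (hV0 : ∀ x, 0 ≤ V x) (hR : RotationBound V Ω)
    (hp : 1 < p) (hint : ∀ φ ∈ X V, Integrable fun x ↦ ‖φ x‖ ^ (p + 1)) (hφ : φ ∈ X V)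
    (hv : v ∈ X V) :
    HasDerivAt (fun t : ℝ ↦ action V p β Ω ω (φ + (t : ℂ) • v))
      (2 * (stationaryForm V p β Ω ω φ v).re) 0 := by
  have h1 := hasDerivAt_integral_norm_rpow (by linarith : 2 < p + 1) (hint φ hφ) (hint v hv)
  have hlin : ∀ a b c : ℝ, HasDerivAt (fun t : ℝ ↦ a + 2 * t * b + t ^ 2 * c) (2 * b) 0 := by
    intro a b c
    have e1 : HasDerivAt (fun t : ℝ ↦ 2 * t * b) (2 * 1 * b) 0 :=
      ((hasDerivAt_id (0 : ℝ)).const_mul 2).mul_const b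
    have e2 : HasDerivAt (fun t : ℝ ↦ t ^ 2 * c) 0 0 := by
      simpa using (hasDerivAt_pow 2 (0 : ℝ)).mul_const c
    convert! (e1.const_add a).add e2 using 1
    ring
  have h2 := ((hlin (linearEnergy V Ω φ) (energyForm V Ω φ v).re (linearEnergy V Ω v)).add
    (h1.const_mul (2 * β / (p + 1)))).add
    ((hlin (‖φ‖ ^ 2) (inner ℂ v φ).re (‖v‖ ^ 2)).const_mul ω)
  refine (h2.congr_deriv ?_).congr_of_eventuallyEq (.of_forall fun t ↦ ?_)
  · have e1 : ∫ x, (p + 1) * ‖φ x‖ ^ (p + 1 - 2) * (φ x * conj (v x)).re =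
        (p + 1) * (∫ x, ((‖φ x‖ ^ (p - 1) : ℝ) : ℂ) * φ x * conj (v x)).re := by
      have := integral_re (integrable_interaction hp (hint φ hφ) (hint v hv))
      change _ = (∫ x, ((‖φ x‖ ^ (p - 1) : ℝ) : ℂ) * φ x * conj (v x)).re at this
      rw [← this, ← integral_const_mul]
      refine integral_congr_ae (.of_forall fun x ↦ ?_)
      change _ = (p + 1) * (((‖φ x‖ ^ (p - 1) : ℝ) : ℂ) * φ x * conj (v x)).re
      rw [mul_assoc ((‖φ x‖ ^ (p - 1) : ℝ) : ℂ), Complex.re_ofReal_mul,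
        show p + 1 - 2 = p - 1 by ring]
      ring
    have hp0 : p + 1 ≠ 0 := by linarith
    rw [e1, stationaryForm, ← integral_mul_conj_eq_inner]
    simp only [Complex.add_re, Complex.re_ofReal_mul]
    field_simp
  · have e : ∫ x, ‖(φ + (t : ℂ) • v : L2 d) x‖ ^ (p + 1) =
        ∫ x, ‖φ x + (t : ℂ) * v x‖ ^ (p + 1) := by
      refine integral_congr_ae ?_
      filter_upwards [Lp.coeFn_add φ ((t : ℂ) • v), Lp.coeFn_smul (t : ℂ) v] with x h3 h4
      rw [h3, Pi.add_apply, h4, Pi.smul_apply, smul_eq_mul]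
    simp only [action, energy, Pi.add_apply]
    rw [linearEnergy_add_smul hV hV0 hR hφ hv, norm_add_smul_sq, e]

/-- Euler-Lagrange equation: a nonzero minimizer of the action is a stationary solution. -/
theorem mem_stationarySolutions_of_minimizer (hV : Measurable V) (hV0 : ∀ x, 0 ≤ V x)
    (hR : RotationBound V Ω) (hp : 1 < p)
    (hint : ∀ φ ∈ X V, Integrable fun x ↦ ‖φ x‖ ^ (p + 1)) (hφ : φ ∈ X V) (hφ0 : φ ≠ 0)
    (hmin : ∀ ψ ∈ X V, action V p β Ω ω φ ≤ action V p β Ω ω ψ) :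
    φ ∈ stationarySolutions V p β Ω ω := by
  rw [mem_stationarySolutions_iff]
  have hre : ∀ v ∈ X V, (stationaryForm V p β Ω ω φ v).re = 0 := fun v hv ↦ by
    have hd := hasDerivAt_action (β := β) (ω := ω) hV hV0 hR hp hint hφ hv
    have hloc : IsLocalMin (fun t : ℝ ↦ action V p β Ω ω (φ + (t : ℂ) • v)) 0 := by
      refine .of_forall fun t ↦ ?_
      simpa using hmin _ (X.add_mem hV hV0 hφ (X.smul_mem (t : ℂ) hv))
    have := hloc.hasDerivAt_eq_zero hd
    linarith
  refine ⟨hφ, hφ0, fun v hv ↦ Complex.ext (hre v hv) ?_⟩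
  -- the direction `i v` yields the imaginary part
  have h := hre _ (X.smul_mem Complex.I hv)
  rw [stationaryForm_smul_right hR _ hφ hv] at h
  simpa using h

/-- Testing the equation with `φ` itself shows that stationary solutions have negative action. -/
theorem action_neg_of_mem_stationarySolutions (hp : 1 < p) (hβ : 0 < β)
    (hint : ∀ φ ∈ X V, Integrable fun x ↦ ‖φ x‖ ^ (p + 1))
    (hφ : φ ∈ stationarySolutions V p β Ω ω) : action V p β Ω ω φ < 0 := by
  obtain ⟨hX, h0, heq⟩ := mem_stationarySolutions_iff.mp hφ
  have h1 := congrArg Complex.re (heq φ hX)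
  have e1 : ∫ x, ((‖φ x‖ ^ (p - 1) : ℝ) : ℂ) * φ x * conj (φ x) =
      ((∫ x, ‖φ x‖ ^ (p + 1) : ℝ) : ℂ) := by
    rw [← integral_complex_ofReal]
    refine integral_congr_ae (.of_forall fun x ↦ ?_)
    simp only
    rw [mul_assoc, Complex.mul_conj', ← Complex.ofReal_pow, ← Complex.ofReal_mul, ← Real.rpow_two,
      ← Real.rpow_add' (norm_nonneg _) (by linarith)]
    ring_nf
  have e2 : ∫ x, φ x * conj (φ x) = ((‖φ‖ ^ 2 : ℝ) : ℂ) := by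
    rw [integral_mul_conj_eq_inner, inner_self_eq_norm_sq_to_K]
    simp
  rw [stationaryForm, e1, e2, Complex.add_re, Complex.add_re, energyForm_self_re,
    Complex.re_ofReal_mul, Complex.re_ofReal_mul, Complex.ofReal_re, Complex.ofReal_re,
    Complex.zero_re] at h1
  have hpos : 0 < ∫ x, ‖φ x‖ ^ (p + 1) := by
    refine lt_of_le_of_ne (integral_nonneg fun x ↦ by positivity) fun h ↦ h0 ?_
    have h2 := (integral_eq_zero_iff_of_nonneg (fun x ↦ by positivity) (hint φ hX)).mp h.symm
    rw [Lp.eq_zero_iff_ae_eq_zero]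
    filter_upwards [h2] with x hx
    have hx' : ‖φ x‖ ^ (p + 1) = 0 := hx
    rw [Real.rpow_eq_zero (norm_nonneg _) (by linarith)] at hx'
    simpa using hx'
  have hlt : 2 * β / (p + 1) < β := by
    rw [div_lt_iff₀ (by linarith)]
    nlinarith
  have h3 := mul_lt_mul_of_pos_right hlt hpos
  simp only [action, energy]
  linarith

/-- As soon as there is a stationary solution, action ground states are exactly the global
minimizers of the action: the minimizer has negative action, hence is a nontrivial stationary
solution. -/
theorem mem_actionGroundStates_iff (hV : Measurable V) (hV0 : ∀ x, 0 ≤ V x)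
    (hVc : Tendsto V (cocompact (Space d)) atTop) (hR : RotationBound V Ω) (hp : 1 < p)
    (hβ : 0 < β) (hint : ∀ φ ∈ X V, Integrable fun x ↦ ‖φ x‖ ^ (p + 1))
    (hne : (stationarySolutions V p β Ω ω).Nonempty) :
    φ ∈ actionGroundStates V p β Ω ω ↔
      φ ∈ X V ∧ ∀ ψ ∈ X V, action V p β Ω ω φ ≤ action V p β Ω ω ψ := by
  obtain ⟨χ, hχ⟩ := hne
  have hχX : χ ∈ X V := hχ.1
  have hχneg := action_neg_of_mem_stationarySolutions hp hβ hint hχ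
  have hstat : ∀ η ∈ X V, (∀ ψ ∈ X V, action V p β Ω ω η ≤ action V p β Ω ω ψ) →
      η ∈ stationarySolutions V p β Ω ω := fun η hη hmin ↦ by
    refine mem_stationarySolutions_of_minimizer hV hV0 hR hp hint hη (fun h0 ↦ ?_) hmin
    have h1 := (hmin χ hχX).trans_lt hχneg
    have h3 : 0 ≤ action V p β Ω ω η := by
      have h4 := linearEnergy_real_smul hR hη 0
      have h5 : 0 ≤ ∫ x, ‖η x‖ ^ (p + 1) := integral_nonneg fun x ↦ by positivity
      have h6 : 0 ≤ 2 * β / (p + 1) * ∫ x, ‖η x‖ ^ (p + 1) := by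
        have : 0 < p + 1 := by linarith
        positivity
      rw [Complex.ofReal_zero, zero_smul, zero_pow two_ne_zero, zero_mul, ← h0] at h4
      simp only [action, energy, h4]
      rw [show ‖η‖ = 0 by rw [h0, norm_zero]]
      linarith
    linarith
  constructor
  · rintro ⟨h1, h2⟩
    obtain ⟨η, hη, hmin⟩ := exists_action_minimizer hV hV0 hVc hR hp hβ hint ω ⟨χ, hχX⟩
    exact ⟨h1.1, fun ψ hψ ↦ (h2 η (hstat η hη hmin)).trans (hmin ψ hψ)⟩
  · rintro ⟨h1, h2⟩
    exact ⟨hstat φ h1 h2, fun ψ hψ ↦ h2 ψ hψ.1⟩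

/-- The mass of action minimizers decreases with the frequency: if `ω₁ > ω₂`, then `φ` is not
heavier than `ψ`. -/
theorem mul_norm_sq_le_of_minimizers {ω₁ ω₂ : ℝ}
    (h1 : action V p β Ω ω₁ φ ≤ action V p β Ω ω₁ ψ)
    (h2 : action V p β Ω ω₂ ψ ≤ action V p β Ω ω₂ φ) :
    (ω₁ - ω₂) * ‖φ‖ ^ 2 ≤ (ω₁ - ω₂) * ‖ψ‖ ^ 2 := by
  simp only [action] at h1 h2
  linarith

/-- If `φ` minimizes the action at `ω₁`, and the mass of `φ` is a limit of masses of minimizers at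
`ω₂`, then `φ` is also a minimizer at `ω₂`. -/
theorem minimizer_of_approx {ω₁ ω₂ : ℝ}
    (h1 : ∀ ψ ∈ X V, action V p β Ω ω₁ φ ≤ action V p β Ω ω₁ ψ)
    (h2 : ∀ ε > 0, ∃ χ ∈ X V, |‖χ‖ ^ 2 - ‖φ‖ ^ 2| < ε ∧
      ∀ ψ ∈ X V, action V p β Ω ω₂ χ ≤ action V p β Ω ω₂ ψ) :
    ∀ ψ ∈ X V, action V p β Ω ω₂ φ ≤ action V p β Ω ω₂ ψ := by
  intro ψ hψ
  refine le_of_forall_pos_le_add fun ε hε ↦ ?_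
  obtain ⟨χ, hχ, hm, hmin⟩ := h2 (ε / (|ω₁ - ω₂| + 1)) (by positivity)
  rw [lt_div_iff₀ (by positivity)] at hm
  have h3 := h1 χ hχ
  have h4 := hmin ψ hψ
  have h5 : (ω₁ - ω₂) * (‖χ‖ ^ 2 - ‖φ‖ ^ 2) ≤ ε := by
    refine (le_abs_self _).trans ?_
    rw [abs_mul]
    nlinarith [abs_nonneg (‖χ‖ ^ 2 - ‖φ‖ ^ 2), abs_nonneg (ω₁ - ω₂)]
  simp only [action] at h3 h4 ⊢
  linarith

end

end RNLS


theorem theorem4p8 (d : ℕ) (hd : 1 ≤ d) (p β Ω : ℝ) (hp : 1 < p)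
    (hpd : 3 ≤ d → p < ((d : ℝ) + 2) / ((d : ℝ) - 2)) (hβ : 0 < β)
    (V : RNLS.Space d → ℝ) (hVmeas : Measurable V) (hVnonneg : ∀ x, 0 ≤ V x)
    (hVconf : Filter.Tendsto V (Filter.cocompact (RNLS.Space d)) Filter.atTop)
    (hΩ : Ω = 0 ∨ (0 < |Ω| ∧ ((|Ω| : ℝ) : EReal) < RNLS.OmegaMax V))
    (ω' : ℝ) (hω' : ω' < -RNLS.lambda0 V Ω) (m : ℝ)
    (hm : m ∈ RNLS.massInterval V p β Ω ω' \ RNLS.massSet V p β Ω ω')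
    (φ : RNLS.L2 d) (hφ : φ ∈ RNLS.energyGroundStates V p β Ω m) :
    ∀ ω : ℝ, φ ∉ RNLS.actionGroundStates V p β Ω ω := by
  open RNLS in
  intro ω hφω
  have hR := rotationBound_of_lt_OmegaMax hVnonneg hΩ
  have hint : ∀ φ ∈ X V, MeasureTheory.Integrable fun x ↦ ‖φ x‖ ^ (p + 1) := fun φ h ↦
    integrable_norm_rpow_add_one hp hpd h.1
  have hiff : ∀ {ω : ℝ} {χ : L2 d}, (stationarySolutions V p β Ω ω).Nonempty →
      (χ ∈ actionGroundStates V p β Ω ω ↔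
        χ ∈ X V ∧ ∀ ψ ∈ X V, action V p β Ω ω χ ≤ action V p β Ω ω ψ) := fun h ↦
    mem_actionGroundStates_iff hVmeas hVnonneg hVconf hR hp hβ hint h
  obtain ⟨⟨hm1, hm2⟩, hmN⟩ := hm
  have hφm : ‖φ‖ ^ 2 = m := hφ.1.2
  have hφ0 : φ ≠ 0 := hφω.1.2.1
  have hmpos : 0 < m := hφm ▸ by positivity
  have hbelow : BddBelow (massSet V p β Ω ω') := ⟨0, by
    rintro _ ⟨χ, -, rfl⟩
    positivity⟩
  -- the real-valued `sSup` vanishes on the empty set and on unbounded sets, while `m > 0`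
  have hne : (massSet V p β Ω ω').Nonempty := by
    by_contra h
    rw [Set.not_nonempty_iff_eq_empty.mp h, Real.sSup_empty] at hm2
    linarith
  have habove : BddAbove (massSet V p β Ω ω') := by
    by_contra h
    rw [Real.sSup_of_not_bddAbove h] at hm2
    linarith
  have hst : (stationarySolutions V p β Ω ω').Nonempty := by
    obtain ⟨_, χ, hχ, -⟩ := hne
    exact ⟨χ, hχ.1⟩
  have hmin := ((hiff ⟨φ, hφω.1⟩).mp hφω).2
  refine hmN ⟨φ, (hiff hst).mpr ⟨hφω.1.1, minimizer_of_approx hmin fun ε hε ↦ ?_⟩, hφm⟩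
  have hcomp : ∀ χ ∈ actionGroundStates V p β Ω ω', (ω - ω') * m ≤ (ω - ω') * ‖χ‖ ^ 2 :=
    fun χ hχ ↦ by
      have h1 := (hiff hst).mp hχ
      rw [← hφm]
      exact mul_norm_sq_le_of_minimizers (hmin χ h1.1) (h1.2 φ hφω.1.1)
  rw [hφm]
  rcases lt_trichotomy ω' ω with h | rfl | h
  · -- all masses at `ω'` are at least `m`, so `m` is their infimum
    obtain ⟨_, ⟨χ, hχ, rfl⟩, hlt⟩ := exists_lt_of_csInf_lt hne
      (by linarith : sInf (massSet V p β Ω ω') < m + ε)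
    have h1 := le_of_mul_le_mul_left (hcomp χ hχ) (by linarith)
    have h2 := (hiff hst).mp hχ
    refine ⟨χ, h2.1, ?_, h2.2⟩
    simp only at hlt
    rw [abs_lt]
    constructor <;> linarith
  · exact absurd ⟨φ, hφω, hφm⟩ hmN
  · obtain ⟨_, ⟨χ, hχ, rfl⟩, hlt⟩ := exists_lt_of_lt_csSup hne
      (by linarith : m - ε < sSup (massSet V p β Ω ω'))
    have h1 : ‖χ‖ ^ 2 ≤ m := by
      have := hcomp χ hχ
      nlinarith
    have h2 := (hiff hst).mp hχ
    refine ⟨χ, h2.1, ?_, h2.2⟩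
    simp only at hlt
    rw [abs_lt]
    constructor <;> linarith
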